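/- **Setting.** Segments are closed segments in the plane with two distinct endpoints. Two segments *cross* if they intersect in a single point that is not an endpoint of either. Let $P$ be a finite set of points in the plane, no three of which are collinear. A *perfect matching* on $P$ with $n$ segments is a multiset of $n$ segments with endpoints in $P$ such that every point of $P$ is an endpoint of exactly one segment (so $|P|=2n$). A *flip* removes two crossing segments $ab, cd$ of a matching and inserts two non-crossing segments with the same four endpoints (either $ac, bd$ or $ad, bc$). The *flip graph* $F$ is the directed graph whose vertices are the perfect matchings on $P$ with $n$ segments and whose arcs are the flips. A *removal and insertion strategy* is a spanning subgraph $RI$ of $F$ that has the same sinks as $F$ and in which every vertex that is not a sink of $F$ has out-degree exactly one. A *flip sequence* of $RI$ is a directed path of $RI$, its *length* is its number of arcs, and it is an *untangle sequence* if it ends in a sink of $F$. **Theorem.** There is an absolute constant $K$ such that the following holds for all $n \ge 0$. Let $P = C \cup T$ be a partition of a finite set of points in the plane, no three of them collinear, where $C$ is in convex position and no point of $T$ lies in the convex hull of $C$, and let $t = |T|$. Then there is a removal and insertion strategy $RI$ for the flip graph of the perfect matchings on $P$ with $n$ segments such that every flip sequence of $RI$, and in particular every untangle sequence of $RI$, has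 length at most $K (1+t)^3 n$. Moreover, from every perfect matching on $P$ with $n$ segments there starts an untangle sequence of $RI$, and it ends in a crossing-free matching. That is, every such matching can be untangled with $O(t^3 n)$ flips (where the factor $t$ is read as $1+t$, so that the bound is $O(n)$ if $T=\emptyset$). -/

import Mathlib

/-- The Euclidean plane. -/
abbrev Plane : Type := EuclideanSpace ℝ (Fin 2)

/-- A segment is given by its unordered pair of endpoints. -/
abbrev Seg : Type := Sym2 Plane

/-- The set of points of the plane covered by a (closed) segment. -/
def Seg.carrier : Seg → Set Plane :=
  Sym2.lift ⟨fun a b => segment ℝ a b, fun a b => segment_symm ℝ a b⟩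

/-- Two segments cross if they intersect at a single point, which is not an endpoint of either. -/
def Crossing (s₁ s₂ : Seg) : Prop :=
  ∃ x : Plane, Seg.carrier s₁ ∩ Seg.carrier s₂ = {x} ∧ x ∉ s₁ ∧ x ∉ s₂

/-- General position: no three distinct points are collinear. -/
def GeneralPosition (P : Finset Plane) : Prop :=
  ∀ a ∈ P, ∀ b ∈ P, ∀ c ∈ P, a ≠ b → a ≠ c → b ≠ c → ¬ Collinear ℝ {a, b, c}

/-- A graph property of a multigraph whose vertices are the points of `P` and whose edges are the
segments of the multiset `S`. -/
abbrev GraphProperty : Type := Finset Plane → Multiset Seg → Prop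

open Classical in
/-- The degree of the point `p`: the number of segments of `S` that have `p` as an endpoint. -/
noncomputable def segDegree (S : Multiset Seg) (p : Plane) : ℕ :=
  S.countP (fun s => p ∈ s)

/-- Being a perfect matching: every point of `P` is an endpoint of exactly one segment. -/
def IsPerfectMatching : GraphProperty :=
  fun P S => ∀ p ∈ P, segDegree S p = 1

/-- The multisets of `n` segments with (distinct) endpoints in `P` that satisfy the graph
property `Γ`: the vertices of the flip graph. -/
def Config (P : Finset Plane) (n : ℕ) (Γ : GraphProperty) : Type :=
  {S : Multiset Seg //
    S.card = n ∧ (∀ s ∈ S, ¬ s.IsDiag ∧ ∀ p ∈ s, p ∈ P) ∧ Γ P S}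

/-- `S'` is obtained from `S` by a flip: two crossing segments `ab`, `cd` are removed and two
non-crossing segments `ac`, `bd` with the same four endpoints are inserted. As segments are
unordered pairs, exchanging the names `c` and `d` gives the other insertion choice `ad`, `bc`. -/
def IsFlip (S S' : Multiset Seg) : Prop :=
  ∃ (a b c d : Plane) (R : Multiset Seg),
    S = s(a, b) ::ₘ s(c, d) ::ₘ R ∧ S' = s(a, c) ::ₘ s(b, d) ::ₘ R ∧
    Crossing s(a, b) s(c, d) ∧ ¬ Crossing s(a, c) s(b, d)

/-- The flip graph. The property `Γ` is preserved by an arc because both ends are vertices. -/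
def flipGraph (P : Finset Plane) (n : ℕ) (Γ : GraphProperty) : Digraph (Config P n Γ) where
  Adj S S' := IsFlip S.1 S'.1

/-- No two of the segments of `S` cross. -/
def CrossingFree (S : Multiset Seg) : Prop :=
  ∀ s₁ ∈ S, ∀ s₂ ∈ S, ¬ Crossing s₁ s₂

/-- A sink of a directed graph is a vertex without outgoing arcs. -/
def IsSink {V : Type} (G : Digraph V) (v : V) : Prop :=
  ∀ w, ¬ G.Adj v w

/-- A strategy for `F` is a spanning subgraph of `F` with the same set of sinks. -/
def IsStrategy {V : Type} (F R : Digraph V) : Prop :=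
  (∀ v w, R.Adj v w → F.Adj v w) ∧ ∀ v, IsSink R v ↔ IsSink F v

/-- A strategy for both removal and insertion choices: every vertex that is not a sink of `F` has
out-degree exactly one. -/
def IsRIStrategy {V : Type} (F RI : Digraph V) : Prop :=
  IsStrategy F RI ∧ ∀ v, ¬ IsSink F v → ∃! w, RI.Adj v w

/-- Flip sequences: directed paths in a flip graph or in a strategy. The field `length` is the
number of arcs (flips), `head` is the first vertex and `last` the final one. -/
abbrev FlipSequence {V : Type} (G : Digraph V) : Type :=
  RelSeries {e : V × V | G.Adj e.1 e.2}

/-- An untangle sequence of a strategy for `F` is a flip sequence that ends in a sink of `F`. -/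
def IsUntangleSequence {V : Type} (F : Digraph V) {G : Digraph V} (σ : FlipSequence G) : Prop :=
  IsSink F σ.last

/-! A strategy may follow shortest paths to crossing-free matchings (`exists_strategy`), so it
suffices to untangle each matching with `1000 * (1 + t) ^ 3 * n` flips
(`OuterPosition.exists_untangling`). Let K be the convex hull of `C`.

The segments with both endpoints in `C` come first, at one flip each: at most one flip produces a
segment with all remaining endpoints strictly on one side of its line, and later flips among those
endpoints never cross it (`OuterPosition.exists_hull_edge`, `OuterPosition.untangle_convex`). At
most t segments remain.

Those of them that meet K are then added one at a time to a crossing-free part `G` of segments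
meeting K (`OuterPosition.insert_segment`). To add pr, flip it with the segment ba of `G` whose
crossing x with pr is closest to p. Then pb replaces ba in `G`, and ra, which crosses fewer segments
of `G`, is added next. This takes O(n) flips unless it fails: a crossing lies outside K, a new
segment misses K, pb crosses `G`, or ra crosses a segment of `G` that pr did not. Each failure
provides a flip that lowers the `energy`, and spoils only boundedly many segments of `G`.

The energy has two parts. Crossings outside K are charged to at most 4t half-planes bounded by the
tangents from `T` to K (`OuterPosition.exists_tangent_family`). For crossings in K, a segment
entering the triangle pbx through pb must end in it, by a Pasch argument; since every point of `P`
is exposed in the hull of K and itself, that end sees p or b (`OuterPosition.visible`), and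
inserting this line of sight settles an endpoint in `T`. The total energy is O(t²).

The crossings left are between segments that miss K. They are flipped to segments that again miss K,
and the half-planes through pairs of points of `T` bound these flips (`OuterPosition.flip_free`).
`OuterPosition.untangle` adds the three potentials to O((n + t²) t² + n t + t³), which is O((1 + t)³
n) since t ≤ 2n. -/

/-! ### Orientations, segments and crossings -/

/-- Twice the signed area of the triangle `abc`; positive when it is counterclockwise. -/
def orient (a b c : Plane) : ℝ := (b 0 - a 0) * (c 1 - a 1) - (b 1 - a 1) * (c 0 - a 0)

theorem plane_ext {a b : Plane} (h0 : a 0 = b 0) (h1 : a 1 = b 1) : a = b := by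
  ext i; fin_cases i <;> assumption

theorem comb_apply (α β : ℝ) (a b : Plane) (i : Fin 2) :
    (α • a + β • b) i = α * a i + β * b i := by simp

theorem comb3_apply (α β γ : ℝ) (a b c : Plane) (i : Fin 2) :
    (α • a + β • b + γ • c) i = α * a i + β * b i + γ * c i := by simp

theorem orient_comb (a b c d : Plane) {α β : ℝ} (h : α + β = 1) :
    orient a b (α • c + β • d) = α * orient a b c + β * orient a b d := by
  obtain rfl : β = 1 - α := by linarith
  simp only [orient, comb_apply]; ring

theorem orient_swap (a b c : Plane) : orient b a c = -orient a b c := by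
  simp only [orient]; ring

theorem orient_swap_right (a b c : Plane) : orient a c b = -orient a b c := by
  simp only [orient]; ring

@[simp] theorem orient_left (a b : Plane) : orient a b a = 0 := by simp only [orient]; ring
@[simp] theorem orient_right (a b : Plane) : orient a b b = 0 := by simp only [orient]; ring
@[simp] theorem orient_self (a b : Plane) : orient a a b = 0 := by simp only [orient]; ring

theorem collinear_of_orient_eq_zero {a b c : Plane} (h : orient a b c = 0) :
    Collinear ℝ {a, b, c} := by
  by_cases hab : a = b
  · subst hab; simpa using collinear_pair ℝ a c
  rw [collinear_iff_of_mem (p₀ := a) (by simp)]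
  have hpos : 0 < (b 0 - a 0) ^ 2 + (b 1 - a 1) ^ 2 := by
    by_contra hn
    have h0 : b 0 - a 0 = 0 := by nlinarith [sq_nonneg (b 0 - a 0), sq_nonneg (b 1 - a 1)]
    have h1 : b 1 - a 1 = 0 := by nlinarith [sq_nonneg (b 0 - a 0), sq_nonneg (b 1 - a 1)]
    exact hab (plane_ext (by linarith) (by linarith))
  refine ⟨b - a, ?_⟩
  rintro p hp
  simp only [Set.mem_insert_iff, Set.mem_singleton_iff] at hp
  rcases hp with rfl | rfl | rfl
  · exact ⟨0, by simp⟩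
  · exact ⟨1, by simp⟩
  -- The parameter is that of the orthogonal projection of p to the line ab.
  · refine ⟨((p 0 - a 0) * (b 0 - a 0) + (p 1 - a 1) * (b 1 - a 1)) /
      ((b 0 - a 0) ^ 2 + (b 1 - a 1) ^ 2), ?_⟩
    simp only [orient] at h
    apply plane_ext <;> simp <;> field_simp
    · linear_combination (-(b 1 - a 1)) * h
    · linear_combination (b 0 - a 0) * h

theorem GeneralPosition.orient_ne_zero {P : Finset Plane} (hP : GeneralPosition P)
    {a b c : Plane} (ha : a ∈ P) (hb : b ∈ P) (hc : c ∈ P) (hab : a ≠ b) (hac : a ≠ c)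
    (hbc : b ≠ c) : orient a b c ≠ 0 :=
  fun h => hP a ha b hb c hc hab hac hbc (collinear_of_orient_eq_zero h)

@[simp] theorem carrier_mk (a b : Plane) : Seg.carrier s(a, b) = segment ℝ a b := rfl

theorem orient_of_mem_openSegment {a b x : Plane} (hx : x ∈ openSegment ℝ a b) :
    orient a b x = 0 := by
  obtain ⟨α, β, -, -, h, rfl⟩ := hx
  simp [orient_comb _ _ _ _ h]

theorem orient_of_mem_segment {a b x : Plane} (hx : x ∈ segment ℝ a b) :
    orient a b x = 0 := by
  obtain ⟨α, β, -, -, h, rfl⟩ := hx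
  simp [orient_comb _ _ _ _ h]

theorem Crossing.symm {s₁ s₂ : Seg} (h : Crossing s₁ s₂) : Crossing s₂ s₁ := by
  obtain ⟨x, h1, h2, h3⟩ := h
  exact ⟨x, by rw [Set.inter_comm]; exact h1, h3, h2⟩

/-- The crossing point of two crossing segments lies in the relative interior of both. -/
theorem Crossing.exists_mem {a b c d : Plane} (h : Crossing s(a, b) s(c, d)) :
    ∃ x, x ∈ openSegment ℝ a b ∧ x ∈ openSegment ℝ c d := by
  obtain ⟨x, hx, h1, h2⟩ := h
  have hm : x ∈ segment ℝ a b ∩ segment ℝ c d := by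
    have : x ∈ Seg.carrier s(a, b) ∩ Seg.carrier s(c, d) := by rw [hx]; rfl
    simpa using this
  simp only [Sym2.mem_iff, not_or] at h1 h2
  exact ⟨x, mem_openSegment_of_ne_left_right (Ne.symm h1.1) (Ne.symm h1.2) hm.1,
    mem_openSegment_of_ne_left_right (Ne.symm h2.1) (Ne.symm h2.2) hm.2⟩

theorem Crossing.disjoint {s₁ s₂ : Seg} (h : Crossing s₁ s₂) {p : Plane} (h1 : p ∈ s₁) :
    p ∉ s₂ := by
  intro h2
  obtain ⟨x, hx, hx1, -⟩ := h
  have key : ∀ s : Seg, p ∈ s → p ∈ Seg.carrier s := by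
    intro s hs
    induction s using Sym2.ind with
    | _ a b =>
      rcases Sym2.mem_iff.1 hs with rfl | rfl
      · exact left_mem_segment ℝ _ _
      · exact right_mem_segment ℝ _ _
  have : p ∈ Seg.carrier s₁ ∩ Seg.carrier s₂ := ⟨key _ h1, key _ h2⟩
  rw [hx] at this
  obtain rfl : p = x := this
  exact hx1 h1

/-- The orientation with respect to ab is affine along cd and vanishes at the interior point x. -/
theorem orient_opposite {a b c d x : Plane} (hx : x ∈ openSegment ℝ a b)
    (hx' : x ∈ openSegment ℝ c d) (h : orient a b c ≠ 0) : orient a b c * orient a b d < 0 := by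
  have h0 := orient_of_mem_openSegment hx
  obtain ⟨α, β, hα, hβ, hs, rfl⟩ := hx'
  rw [orient_comb _ _ _ _ hs] at h0
  have : orient a b d = -(α / β) * orient a b c := by field_simp; linarith
  rw [this]
  have h2 : 0 < orient a b c ^ 2 := by positivity
  have h3 : 0 < α / β := by positivity
  nlinarith [mul_pos h2 h3]

/-- Two segments not on a common line whose relative interiors meet are crossing. -/
theorem crossing_of_mem {a b c d x : Plane} (hx : x ∈ openSegment ℝ a b)
    (hx' : x ∈ openSegment ℝ c d) (h : orient a b c ≠ 0) : Crossing s(a, b) s(c, d) := by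
  have hd : orient a b d ≠ 0 := fun h0 => by
    have := orient_opposite hx hx' h; simp [h0] at this
  have h0 := orient_of_mem_openSegment hx
  have hopp := orient_opposite hx hx' h
  refine ⟨x, ?_, ?_, ?_⟩
  · apply Set.eq_singleton_iff_unique_mem.2
    refine ⟨⟨openSegment_subset_segment _ _ _ hx, openSegment_subset_segment _ _ _ hx'⟩, ?_⟩
    rintro y ⟨hy1, hy2⟩
    have hy0 := orient_of_mem_segment (a := a) (b := b) hy1
    obtain ⟨α, β, -, -, hs, rfl⟩ := hx'
    obtain ⟨γ, δ, -, -, hs', rfl⟩ := hy2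
    rw [orient_comb _ _ _ _ hs] at h0
    rw [orient_comb _ _ _ _ hs'] at hy0
    change γ * orient a b c + δ * orient a b d = 0 at hy0
    have hne : orient a b c - orient a b d ≠ 0 := by
      intro h3
      have : orient a b c = orient a b d := by linarith
      rw [this] at hopp; nlinarith [sq_nonneg (orient a b d)]
    have : (α - γ) * (orient a b c - orient a b d) = 0 := by
      have e1 : β = 1 - α := by linarith
      have e2 : δ = 1 - γ := by linarith
      subst e1 e2; linarith
    have : α = γ := by
      rcases mul_eq_zero.1 this with h4 | h4
      · linarith
      · exact absurd h4 hne
    subst this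
    have : β = δ := by linarith
    subst this; rfl
  · rw [Sym2.mem_iff]
    have hab : a ≠ b := by rintro rfl; simp at h
    rintro (rfl | rfl)
    · exact hab ((left_mem_openSegment_iff).1 hx)
    · exact hab ((right_mem_openSegment_iff).1 hx)
  · rw [Sym2.mem_iff]
    rintro (rfl | rfl)
    · exact h h0
    · exact hd h0

/-- The two segments inserted by a flip do not cross. -/
theorem not_crossing_flip {a b c d x : Plane} (hx : x ∈ openSegment ℝ a b)
    (hx' : x ∈ openSegment ℝ c d) (h : orient a b c ≠ 0) : ¬ Crossing s(a, c) s(b, d) := by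
  intro hc
  obtain ⟨y, hy1, hy2⟩ := hc.exists_mem
  have hopp := orient_opposite hx hx' h
  obtain ⟨α, β, hα, hβ, hs, rfl⟩ := hy1
  obtain ⟨γ, δ, hγ, hδ, hs', he⟩ := hy2
  -- The interior of ac lies strictly on the side of c with respect to ab, that of bd strictly on
  -- the side of d, and these sides are opposite.
  have e := congrArg (orient a b) he
  rw [orient_comb _ _ _ _ hs, orient_comb _ _ _ _ hs'] at e
  simp only [orient_left, orient_right, mul_zero, zero_add] at e
  rcases lt_or_gt_of_ne h with h1 | h1
  · have : 0 < orient a b d := by nlinarith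
    nlinarith [mul_pos hδ this, mul_pos hβ (neg_pos.2 h1)]
  · have : orient a b d < 0 := by nlinarith
    nlinarith [mul_pos hδ (neg_pos.2 this), mul_pos hβ h1]

/-- Barycentric coordinates. -/
theorem exists_barycentric {a b c : Plane} (h : orient a b c ≠ 0) (z : Plane) :
    z = (orient b c z / orient a b c) • a + (orient c a z / orient a b c) • b +
      (orient a b z / orient a b c) • c ∧
    orient b c z / orient a b c + orient c a z / orient a b c + orient a b z / orient a b c = 1 := by
  constructor
  · apply plane_ext <;> rw [comb3_apply] <;> field_simp <;> simp only [orient] <;> ring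
  · rw [← add_div, ← add_div, div_eq_one_iff_eq h]; simp only [orient]; ring

theorem not_mem_of_mem_openSegment {P : Finset Plane} (hP : GeneralPosition P) {a b p : Plane}
    (ha : a ∈ P) (hb : b ∈ P) (hab : a ≠ b) (hp : p ∈ openSegment ℝ a b) : p ∉ P := by
  intro h
  have h0 := orient_of_mem_openSegment hp
  refine hP.orient_ne_zero ha hb h hab ?_ ?_ h0
  · rintro rfl; exact hab (left_mem_openSegment_iff.1 hp)
  · rintro rfl; exact hab (right_mem_openSegment_iff.1 hp)

/-! ### Segments entering a triangle -/

/-- A segment through the side `pb` of a triangle `pbx` ends inside the triangle or leaves it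
through the two other sides. -/
theorem pasch_aux {p b x e f v : Plane} (hv : v ∈ openSegment ℝ p b)
    (hv' : v ∈ openSegment ℝ e f) (hx : orient p b x ≠ 0)
    (he : 0 < orient p b e / orient p b x) :
    (∃ w ∈ segment ℝ e f, w ∈ openSegment ℝ p x ∨ w ∈ openSegment ℝ x b ∨ w = x) ∨
    ∃ α β γ : ℝ, 0 < α ∧ 0 < β ∧ 0 < γ ∧ α + β + γ = 1 ∧ e = α • p + β • b + γ • x := by
  obtain ⟨hbar, hsum⟩ := exists_barycentric hx e
  set α := orient b x e / orient p b x
  set β := orient x p e / orient p b x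
  set γ := orient p b e / orient p b x
  have hvs : v ∈ segment ℝ e f := openSegment_subset_segment _ _ _ hv'
  have hes : e ∈ segment ℝ e f := left_mem_segment _ _ _
  have hcv := (convex_segment (𝕜 := ℝ) e f)
  obtain ⟨l, m, hl, hm, hlm, rfl⟩ := hv
  -- On the way from v to e, at the point where the p-coordinate vanishes, the b-coordinate has the
  -- sign of lβ - αm. If that is nonnegative, the point lies on the side xb or is x. The next case
  -- is the same with p and b exchanged; if neither occurs, all coordinates of e are positive.
  by_cases h1 : α ≤ 0 ∧ 0 ≤ l * β - α * m
  · left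
    obtain ⟨hα, h1⟩ := h1
    have hd : 0 < l - α := by linarith
    have hw := hcv hvs hes (a := (-α) / (l - α)) (b := l / (l - α))
      (div_nonneg (by linarith) hd.le) (div_nonneg hl.le hd.le) (by field_simp; ring)
    refine ⟨_, hw, Or.inr ?_⟩
    have e1 : (-α / (l - α)) • (l • p + m • b) + (l / (l - α)) • e =
        (l / (l - α) * γ) • x + ((l * β - α * m) / (l - α)) • b := by
      conv_lhs => rw [hbar]
      apply plane_ext <;> simp <;> field_simp <;> ring
    have e2 : l / (l - α) * γ + (l * β - α * m) / (l - α) = 1 := by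
      field_simp; linear_combination l * hsum - α * hlm
    rw [e1]
    rcases h1.eq_or_lt with h2 | h2
    · right
      rw [← h2] at e2 ⊢
      simp at e2 ⊢
      rw [e2, one_smul]
    · left
      exact ⟨_, _, by positivity, by positivity, e2, rfl⟩
  by_cases h2 : β ≤ 0 ∧ l * β - α * m ≤ 0
  · left
    obtain ⟨hβ, h2⟩ := h2
    have hd : 0 < m - β := by linarith
    have hw := hcv hvs hes (a := (-β) / (m - β)) (b := m / (m - β))
      (div_nonneg (by linarith) hd.le) (div_nonneg hm.le hd.le) (by field_simp; ring)
    refine ⟨_, hw, ?_⟩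
    have e1 : (-β / (m - β)) • (l • p + m • b) + (m / (m - β)) • e =
        ((α * m - l * β) / (m - β)) • p + (m / (m - β) * γ) • x := by
      conv_lhs => rw [hbar]
      apply plane_ext <;> simp <;> field_simp <;> ring
    have e2 : (α * m - l * β) / (m - β) + m / (m - β) * γ = 1 := by
      field_simp; linear_combination m * hsum - β * hlm
    rw [e1]
    rcases h2.eq_or_lt with h3 | h3
    · right; right
      have : α * m - l * β = 0 := by linarith
      rw [this] at e2 ⊢
      simp at e2 ⊢
      rw [e2, one_smul]
    · left
      have : 0 < α * m - l * β := by linarith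
      exact ⟨_, _, by positivity, by positivity, e2, rfl⟩
  · right
    refine ⟨α, β, γ, ?_, ?_, he, hsum, hbar⟩
    · by_contra hn
      push Not at hn h1 h2
      have h3 := h1 hn
      have : β ≤ 0 := by
        by_contra hb; push Not at hb
        nlinarith [mul_pos hl hb, mul_nonneg (neg_nonneg.2 hn) hm.le]
      linarith [h2 this]
    · by_contra hn
      push Not at hn h1 h2
      have h3 := h2 hn
      have : α ≤ 0 := by
        by_contra hb; push Not at hb
        nlinarith [mul_pos hb hm, mul_nonneg (neg_nonneg.2 hn) hl.le]
      linarith [h1 this]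

/-- As v is interior to ef and on the line pb, exactly one of e and f lies on the side of x;
`pasch_aux` applies to that one. -/
theorem pasch {p b x e f v : Plane} (hv : v ∈ openSegment ℝ p b)
    (hv' : v ∈ openSegment ℝ e f) (hx : orient p b x ≠ 0) (he : orient p b e ≠ 0) :
    (∃ w ∈ segment ℝ e f, w ∈ openSegment ℝ p x ∨ w ∈ openSegment ℝ x b ∨ w = x) ∨
    ∃ g h : Plane, s(g, h) = s(e, f) ∧
      ∃ α β γ : ℝ, 0 < α ∧ 0 < β ∧ 0 < γ ∧ α + β + γ = 1 ∧ g = α • p + β • b + γ • x := by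
  have hopp := orient_opposite hv hv' he
  by_cases h : 0 < orient p b e / orient p b x
  · rcases pasch_aux hv hv' hx h with h1 | h1
    · exact Or.inl h1
    · exact Or.inr ⟨e, f, rfl, h1⟩
  · have h2 : 0 < orient p b f / orient p b x := by
      push Not at h
      rcases lt_or_gt_of_ne hx with h3 | h3
      · rw [div_nonpos_iff] at h
        have : 0 < orient p b e := by
          rcases h with h | h
          · exact lt_of_le_of_ne h.1 (Ne.symm he)
          · linarith
        exact div_pos_of_neg_of_neg (by nlinarith) h3
      · rw [div_nonpos_iff] at h
        have : orient p b e < 0 := by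
          rcases h with h | h
          · linarith
          · exact lt_of_le_of_ne h.1 he
        exact div_pos (by nlinarith) h3
    rw [openSegment_symm] at hv'
    rcases pasch_aux hv hv' hx h2 with h1 | h1
    · rw [segment_symm] at h1; exact Or.inl h1
    · exact Or.inr ⟨f, e, Sym2.eq_swap, h1⟩

/-! ### Outer position and visibility -/

/-- The points of `P` are split into points `C` in convex position and points `T` outside of the
convex hull of `C`. -/
structure OuterPosition (P C T : Finset Plane) : Prop where
  mem_iff : ∀ p, p ∈ P ↔ p ∈ C ∨ p ∈ T
  disjoint : Disjoint C T
  general : GeneralPosition P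
  convex : ConvexIndependent ℝ (fun c : {x : Plane // x ∈ C} => (c : Plane))
  outside : ∀ q ∈ T, q ∉ convexHull ℝ (C : Set Plane)

theorem isClosed_hull (C : Finset Plane) : IsClosed (convexHull ℝ (C : Set Plane)) :=
  C.finite_toSet.isClosed_convexHull ℝ

/-- Every point of `P` is an exposed point of the convex hull of `C` and itself. -/
theorem OuterPosition.exists_functional {P C T : Finset Plane} (h : OuterPosition P C T)
    {e : Plane} (he : e ∈ P) :
    ∃ l : Plane →L[ℝ] ℝ, ∀ z ∈ convexHull ℝ (C : Set Plane), z ≠ e → l z < l e := by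
  rcases (h.mem_iff e).1 he with hC | hT
  · have hnot : e ∉ convexHull ℝ ((C : Set Plane) \ {e}) := by
      have := (convexIndependent_set_iff_notMem_convexHull_sdiff (s := (C : Set Plane))).1 h.convex
      exact this e hC
    have hcl : IsClosed (convexHull ℝ ((C : Set Plane) \ {e})) :=
      (C.finite_toSet.subset Set.sdiff_subset).isClosed_convexHull ℝ
    obtain ⟨l, u, h1, h2⟩ := geometric_hahn_banach_closed_point (convex_convexHull ℝ _) hcl hnot
    refine ⟨l, ?_⟩
    -- An open half-plane together with a single boundary point is convex.
    have hsub : convexHull ℝ (C : Set Plane) ⊆ {z | l z < l e ∨ z = e} := by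
      apply convexHull_min
      · intro z hz
        by_cases hze : z = e
        · exact Or.inr hze
        · exact Or.inl ((h1 z (subset_convexHull ℝ _ ⟨hz, hze⟩)).trans h2)
      · intro z hz w hw a b ha hb hab
        have hl : l (a • z + b • w) = a * l z + b * l w := by simp
        have hle : l e = a * l e + b * l e := by rw [← add_mul, hab, one_mul]
        rcases ha.eq_or_lt with rfl | ha'
        · obtain rfl : b = 1 := by linarith
          simpa using hw
        rcases hb.eq_or_lt with rfl | hb'
        · obtain rfl : a = 1 := by linarith
          simpa using hz
        rcases hz with hz | rfl
        · left
          rw [hl, hle]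
          have : l w ≤ l e := by rcases hw with hw | rfl; exacts [hw.le, le_rfl]
          nlinarith
        · rcases hw with hw | rfl
          · left; rw [hl]; nlinarith
          · right; rw [← add_smul, hab, one_smul]
    intro z hz hze
    exact (hsub hz).resolve_right hze
  · obtain ⟨l, u, h1, h2⟩ :=
      geometric_hahn_banach_closed_point (convex_convexHull ℝ _) (isClosed_hull C) (h.outside e hT)
    exact ⟨l, fun z hz _ => (h1 z hz).trans h2⟩

/-- A point of `P` inside a triangle with a vertex in the convex hull of `C` sees one of the two
other vertices. -/
theorem OuterPosition.visible {P C T : Finset Plane} (h : OuterPosition P C T)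
    {p b x e : Plane} (he : e ∈ P) (hx : x ∈ convexHull ℝ (C : Set Plane)) {α β γ : ℝ}
    (hα : 0 < α) (hβ : 0 < β) (hγ : 0 < γ) (hsum : α + β + γ = 1)
    (hc : e = α • p + β • b + γ • x) :
    (∀ z ∈ convexHull ℝ (C : Set Plane), z ∈ segment ℝ p e → z = e) ∨
    (∀ z ∈ convexHull ℝ (C : Set Plane), z ∈ segment ℝ b e → z = e) := by
  obtain ⟨l, hl⟩ := h.exists_functional he
  by_contra hn
  push Not at hn
  -- If the hull blocks the view from q to e, then l is smaller at q than at e. Blocking both p and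
  -- b would make l e a positive combination of values at most l e, two of them strictly smaller.
  have key : ∀ q, (∃ z ∈ convexHull ℝ (C : Set Plane), z ∈ segment ℝ q e ∧ z ≠ e) →
      l q < l e := by
    rintro q ⟨z, hz, ⟨a, b, ha, hb, hab, rfl⟩, hze⟩
    have h1 := hl _ hz hze
    have h2 : l (a • q + b • e) = a * l q + b * l e := by simp
    rw [h2] at h1
    obtain rfl : b = 1 - a := by linarith
    by_contra hcon
    push Not at hcon
    nlinarith
  have h1 := key p hn.1
  have h2 := key b hn.2
  have h3 : l x ≤ l e := by
    by_cases hxe : x = e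
    · rw [hxe]
    · exact (hl x hx hxe).le
  have h4 : l e = α * l p + β * l b + γ * l x := by
    conv_lhs => rw [hc]
    simp
  have h5 : l e = α * l e + β * l e + γ * l e := by rw [← add_mul, ← add_mul, hsum, one_mul]
  nlinarith

/-! ### Extreme points as seen from an outer point -/

/-- In a finite set of points that lie strictly on one side of a line through `q`, there is a
clockwise-first point as seen from `q`. -/
theorem exists_orient_nonpos {A : Finset Plane} (hA : A.Nonempty) {q : Plane} {v₀ v₁ : ℝ}
    (hv : ∀ c ∈ A, 0 < v₀ * (c 0 - q 0) + v₁ * (c 1 - q 1)) :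
    ∃ m ∈ A, ∀ c ∈ A, orient q m c ≤ 0 := by
  -- The quotient is the tangent of the angle from v to c - q; it orders the points by angle because
  -- they all lie strictly in front of q.
  obtain ⟨m, hm, hmax⟩ := A.exists_max_image
    (fun c => (v₀ * (c 1 - q 1) - v₁ * (c 0 - q 0)) / (v₀ * (c 0 - q 0) + v₁ * (c 1 - q 1))) hA
  refine ⟨m, hm, fun c hc => ?_⟩
  have h1 := hmax c hc
  rw [div_le_div_iff₀ (hv c hc) (hv m hm)] at h1
  have hpos : 0 < v₀ ^ 2 + v₁ ^ 2 := by
    by_contra hn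
    have e0 : v₀ = 0 := by nlinarith [sq_nonneg v₀, sq_nonneg v₁]
    have e1 : v₁ = 0 := by nlinarith [sq_nonneg v₀, sq_nonneg v₁]
    have := hv m hm
    simp [e0, e1] at this
  have h2 : (v₀ ^ 2 + v₁ ^ 2) * orient q m c ≤ 0 := by
    simp only [orient]; nlinarith
  by_contra hn
  push Not at hn
  nlinarith [mul_pos hpos hn]

theorem exists_orient_nonneg {A : Finset Plane} (hA : A.Nonempty) {q : Plane} {v₀ v₁ : ℝ}
    (hv : ∀ c ∈ A, 0 < v₀ * (c 0 - q 0) + v₁ * (c 1 - q 1)) :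
    ∃ m ∈ A, ∀ c ∈ A, 0 ≤ orient q m c := by
  obtain ⟨m, hm, hmax⟩ := A.exists_min_image
    (fun c => (v₀ * (c 1 - q 1) - v₁ * (c 0 - q 0)) / (v₀ * (c 0 - q 0) + v₁ * (c 1 - q 1))) hA
  refine ⟨m, hm, fun c hc => ?_⟩
  have h1 := hmax c hc
  rw [div_le_div_iff₀ (hv m hm) (hv c hc)] at h1
  have hpos : 0 < v₀ ^ 2 + v₁ ^ 2 := by
    by_contra hn
    have e0 : v₀ = 0 := by nlinarith [sq_nonneg v₀, sq_nonneg v₁]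
    have e1 : v₁ = 0 := by nlinarith [sq_nonneg v₀, sq_nonneg v₁]
    have := hv m hm
    simp [e0, e1] at this
  have h2 : 0 ≤ (v₀ ^ 2 + v₁ ^ 2) * orient q m c := by
    simp only [orient]; nlinarith
  by_contra hn
  push Not at hn
  nlinarith [mul_neg_of_pos_of_neg hpos hn]

theorem exists_direction {C : Finset Plane} {q : Plane}
    (hq : q ∉ convexHull ℝ (C : Set Plane)) :
    ∃ v₀ v₁ : ℝ, ∀ c ∈ C, 0 < v₀ * (c 0 - q 0) + v₁ * (c 1 - q 1) := by
  obtain ⟨l, u, h1, h2⟩ :=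
    geometric_hahn_banach_point_closed (convex_convexHull ℝ _) (isClosed_hull C) hq
  set v := (InnerProductSpace.toDual ℝ Plane).symm l with hv
  have hl : ∀ z, l z = v 0 * z 0 + v 1 * z 1 := by
    intro z
    rw [← InnerProductSpace.toDual_symm_apply (x := z) (y := l), PiLp.inner_apply]
    simp [Fin.sum_univ_two, hv, mul_comm]
  refine ⟨v 0, v 1, fun c hc => ?_⟩
  have := h1.trans (h2 c (subset_convexHull ℝ _ hc))
  rw [hl, hl] at this
  linarith

/-! ### Splits of the plane -/

/-- The set `H` separates the endpoints of the segment `s`. -/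
def Separates (H : Set Plane) (s : Seg) : Prop := (∃ p ∈ s, p ∈ H) ∧ ∃ p ∈ s, p ∉ H

theorem separates_mk {H : Set Plane} {a b : Plane} :
    Separates H s(a, b) ↔ (a ∈ H ∧ b ∉ H) ∨ (b ∈ H ∧ a ∉ H) := by
  simp only [Separates, Sym2.mem_iff]
  constructor
  · rintro ⟨⟨p, rfl | rfl, hp⟩, ⟨q, rfl | rfl, hq⟩⟩ <;> tauto
  · rintro (⟨h1, h2⟩ | ⟨h1, h2⟩)
    · exact ⟨⟨a, Or.inl rfl, h1⟩, ⟨b, Or.inr rfl, h2⟩⟩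
    · exact ⟨⟨b, Or.inr rfl, h1⟩, ⟨a, Or.inl rfl, h2⟩⟩

/-- No segment with both endpoints in `H` meets a segment with both endpoints outside of `H`. -/
def IsSplit (H : Set Plane) : Prop :=
  ∀ ⦃a b c d x : Plane⦄, a ∈ H → b ∈ H → a ≠ b → c ∉ H → d ∉ H →
    x ∈ openSegment ℝ a b → x ∈ openSegment ℝ c d → False

/-- The open half-plane to the left of the line from `u` to `v`, together with the points of `Z`. -/
def leftSide (u v : Plane) (Z : Set Plane) : Set Plane := {z | 0 < orient u v z ∨ z ∈ Z}

/-- Of two distinct points of the set at most one is on the line, so the points between them are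
strictly to the left. The optional boundary point lets a tangent half-plane contain or omit its own
point of `T`. -/
theorem isSplit_leftSide {u v : Plane} {Z : Set Plane} (hZ : Z.Subsingleton)
    (h0 : ∀ z ∈ Z, orient u v z = 0) : IsSplit (leftSide u v Z) := by
  intro a b c d x ha hb hab hc hd hx hx'
  simp only [leftSide, Set.mem_ofPred_eq, not_or, not_lt] at ha hb hc hd
  obtain ⟨α, β, hα, hβ, hs, rfl⟩ := hx
  obtain ⟨γ, δ, hγ, hδ, hs', he⟩ := hx'
  have e := congrArg (orient u v) he
  rw [orient_comb _ _ _ _ hs, orient_comb _ _ _ _ hs'] at e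
  have h1 : γ * orient u v c + δ * orient u v d ≤ 0 := by nlinarith
  have h2 : 0 < α * orient u v a + β * orient u v b := by
    rcases ha with ha | ha <;> rcases hb with hb | hb
    · positivity
    · rw [h0 _ hb]; simp; positivity
    · rw [h0 _ ha]; simp; positivity
    · exact absurd (hZ ha hb) hab
  linarith

/-- Splits of the plane do not separate more segments after a flip than before. -/
theorem separates_flip {H : Set Plane} (hH : IsSplit H) {a b c d x : Plane}
    (hx : x ∈ openSegment ℝ a b) (hx' : x ∈ openSegment ℝ c d) (hab : a ≠ b) (hcd : c ≠ d) :
    ((Separates H s(a, c) ∨ Separates H s(b, d)) →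
      (Separates H s(a, b) ∨ Separates H s(c, d))) ∧
    ((Separates H s(a, c) ∧ Separates H s(b, d)) →
      (Separates H s(a, b) ∧ Separates H s(c, d))) := by
  -- Only with one removed segment inside and the other outside could a flip create separated
  -- segments, and a split excludes this.
  have h1 : a ∈ H → b ∈ H → c ∉ H → d ∉ H → False :=
    fun ha hb hc hd => hH ha hb hab hc hd hx hx'
  have h2 : c ∈ H → d ∈ H → a ∉ H → b ∉ H → False :=
    fun ha hb hc hd => hH ha hb hcd hc hd hx' hx
  simp only [separates_mk]
  by_cases ha : a ∈ H <;> by_cases hb : b ∈ H <;> by_cases hc : c ∈ H <;> by_cases hd : d ∈ H <;>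
    simp_all

/-! ### Tangents to the hull -/

theorem mem_hull_orient_nonpos {C : Finset Plane} {u v : Plane}
    (h : ∀ c ∈ C, orient u v c ≤ 0) {k : Plane} (hk : k ∈ convexHull ℝ (C : Set Plane)) :
    orient u v k ≤ 0 := by
  have : convexHull ℝ (C : Set Plane) ⊆ {z | orient u v z ≤ 0} := by
    apply convexHull_min
    · intro z hz; exact h z hz
    · intro z hz w hw a b ha hb hab
      simp only [Set.mem_ofPred_eq] at hz hw ⊢
      rw [orient_comb _ _ _ _ hab]
      nlinarith
  exact this hk

/-- If a half-plane has the convex hull of `C` strictly on its other side, then the line through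
two of its points leaves the hull on one side. -/
theorem ray_misses {C : Finset Plane} {l : Plane →L[ℝ] ℝ} {u : ℝ} {q q' : Plane}
    (hK : ∀ k ∈ convexHull ℝ (C : Set Plane), l k < u) (hq : u ≤ l q) (hq' : u ≤ l q') :
    (∀ r : ℝ, 0 < r → q + r • (q' - q) ∉ convexHull ℝ (C : Set Plane)) ∨
    (∀ r : ℝ, 0 < r → q' + r • (q - q') ∉ convexHull ℝ (C : Set Plane)) := by
  by_contra hn
  push Not at hn
  obtain ⟨⟨r, hr, h1⟩, ⟨r', hr', h2⟩⟩ := hn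
  have e1 := hK _ h1
  have e2 := hK _ h2
  simp only [map_add, map_smul, map_sub, smul_eq_mul] at e1 e2
  -- If both rays reached the hull, then l would be strictly smaller at each of q, q' than at the
  -- other.
  have h3 : l q' - l q < 0 := by
    by_contra hc; push Not at hc; nlinarith [mul_nonneg hr.le hc]
  nlinarith [mul_pos_of_neg_of_neg h3 (show -r' < 0 by linarith)]

/-- A point outside of the cone at `q` spanned by the convex hull of `C` is beyond one of its
two sides. -/
theorem OuterPosition.beyond_tangent {P C T : Finset Plane} (h : OuterPosition P C T)
    {q q' m m' : Plane} (hq : q ∈ T) (hq' : q' ∈ T) (hne : q ≠ q') (hm : m ∈ C) (hm' : m' ∈ C)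
    (h1 : ∀ c ∈ C, orient q m c ≤ 0)
    (hray : ∀ r : ℝ, 0 < r → q + r • (q' - q) ∉ convexHull ℝ (C : Set Plane)) :
    0 < orient q m q' ∨ 0 < orient m' q q' := by
  by_contra hn
  push Not at hn
  obtain ⟨n1, n2⟩ := hn
  have hTC : ∀ {x c : Plane}, x ∈ T → c ∈ C → x ≠ c := by
    rintro x c hx hc rfl
    exact Finset.disjoint_left.1 h.disjoint hc hx
  have hP : ∀ {x}, x ∈ T → x ∈ P := fun hx => (h.mem_iff _).2 (Or.inr hx)
  have hPC : ∀ {x}, x ∈ C → x ∈ P := fun hx => (h.mem_iff _).2 (Or.inl hx)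
  have hqm := h.general.orient_ne_zero (hP hq) (hPC hm) (hP hq') (hTC hq hm) hne
    (hTC hq' hm).symm
  by_cases hmm : m = m'
  · subst hmm
    rw [orient_swap] at n2
    exact hqm (by linarith)
  have hD : 0 < orient q m' m := by
    have := h1 m' hm'
    rw [orient_swap_right] at this
    have h0 := h.general.orient_ne_zero (hP hq) (hPC hm') (hPC hm) (hTC hq hm') (hTC hq hm)
      (Ne.symm hmm)
    exact lt_of_le_of_ne (by linarith) (Ne.symm h0)
  set D := orient q m' m
  have hA : 0 ≤ orient q m' q' / D := div_nonneg (by rw [orient_swap] at n2; linarith) hD.le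
  have hB : 0 < -orient q m q' / D := div_pos (by
    have := lt_of_le_of_ne n1 hqm; linarith) hD
  set A := orient q m' q' / D
  set B := -orient q m q' / D
  -- If q' were beyond neither tangent, it would have nonnegative coordinates in the basis m - q, m'
  -- - q; rescaling them to sum one gives a point of mm' on the ray.
  have hid : q' - q = A • (m - q) + B • (m' - q) := by
    have hD0 : orient q m' m ≠ 0 := hD.ne'
    apply plane_ext <;> simp [A, B, D] <;> field_simp <;> simp only [orient] <;> ring
  have hAB : 0 < A + B := by linarith
  apply hray (1 / (A + B)) (by positivity)
  have : q + (1 / (A + B)) • (q' - q) = (A / (A + B)) • m + (B / (A + B)) • m' := by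
    rw [hid]
    apply plane_ext <;> simp <;> field_simp <;> ring
  rw [this]
  exact convex_convexHull ℝ _ (subset_convexHull ℝ _ hm) (subset_convexHull ℝ _ hm')
    (by positivity) (by positivity) (by field_simp)

/-- On a segment that meets the hull, a point outside of the hull lies between an endpoint and
the hull. -/
theorem exists_param_between {C : Finset Plane} {a b x k : Plane} (hx : x ∈ openSegment ℝ a b)
    (hk : k ∈ segment ℝ a b) (hkK : k ∈ convexHull ℝ (C : Set Plane))
    (hxK : x ∉ convexHull ℝ (C : Set Plane)) :
    ∃ p r, s(p, r) = s(a, b) ∧ ∃ s t : ℝ, 0 < s ∧ s < t ∧ t ≤ 1 ∧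
      x = (1 - s) • p + s • r ∧ k = (1 - t) • p + t • r := by
  obtain ⟨s', s, hs', hs, hss, rfl⟩ := hx
  obtain ⟨t', t, ht', ht, htt, rfl⟩ := hk
  obtain rfl : s' = 1 - s := by linarith
  obtain rfl : t' = 1 - t := by linarith
  rcases lt_trichotomy s t with hlt | heq | hgt
  · exact ⟨a, b, rfl, s, t, hs, hlt, by linarith, rfl, rfl⟩
  · subst heq; exact absurd hkK hxK
  · refine ⟨b, a, Sym2.eq_swap, 1 - s, 1 - t, by linarith, by linarith, by linarith, ?_, ?_⟩ <;>
      (rw [add_comm]; simp)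

theorem openSegment_of_eq {a b c d x : Plane} (h : s(a, b) = s(c, d))
    (hx : x ∈ openSegment ℝ a b) : x ∈ openSegment ℝ c d := by
  rcases Sym2.eq_iff.1 h with ⟨rfl, rfl⟩ | ⟨rfl, rfl⟩
  · exact hx
  · rwa [openSegment_symm]

theorem segment_of_eq {a b c d x : Plane} (h : s(a, b) = s(c, d))
    (hx : x ∈ segment ℝ a b) : x ∈ segment ℝ c d := by
  rcases Sym2.eq_iff.1 h with ⟨rfl, rfl⟩ | ⟨rfl, rfl⟩
  · exact hx
  · rwa [segment_symm]

/-- The half-planes bounded by the tangent of the hull at `q`: one of them witnesses that two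
segments which cross outside of the hull can be flipped to the advantage of that half-plane. -/
theorem leftSide_of_between {C : Finset Plane}
    {q r q' r' k k' : Plane} {s t s' t' : ℝ} (hs : 0 < s) (hst : s < t)
    (hk : k = (1 - t) • q + t • r)
    (hs' : 0 < s') (hst' : s' < t') (ht' : t' ≤ 1)
    (hk' : k' = (1 - t') • q' + t' • r')
    (hkK : k ∈ convexHull ℝ (C : Set Plane)) (hkK' : k' ∈ convexHull ℝ (C : Set Plane))
    (hqr : q ≠ r) (hqr' : q ≠ r') {u v : Plane}
    (hu : orient u v q = 0) (hCu : ∀ c ∈ C, orient u v c ≤ 0) (hpos : 0 < orient u v q') :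
    q ∈ leftSide u v {q} ∧ q' ∈ leftSide u v {q} ∧ r ∉ leftSide u v {q} ∧
      r' ∉ leftSide u v {q} := by
  have e1 := mem_hull_orient_nonpos hCu hkK
  have e2 := mem_hull_orient_nonpos hCu hkK'
  rw [hk, orient_comb _ _ _ _ (by ring), hu] at e1
  rw [hk', orient_comb _ _ _ _ (by ring)] at e2
  refine ⟨Or.inr rfl, Or.inl hpos, ?_, ?_⟩
  · rintro (h1 | h1)
    · nlinarith
    · exact hqr h1.symm
  · rintro (h1 | h1)
    · nlinarith [mul_nonneg (show (0:ℝ) ≤ 1 - t' by linarith) hpos.le,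
        mul_pos (show (0:ℝ) < t' by linarith) h1]
    · exact hqr' h1.symm

/-- From x to k the functional falls, so it is still larger at q, which lies before x on the same
line. -/
theorem lt_of_between {l : Plane →L[ℝ] ℝ} {u s t : ℝ} {q r x k : Plane} (hs : 0 < s) (hst : s < t)
    (hx : x = (1 - s) • q + s • r) (hk : k = (1 - t) • q + t • r) (h1 : l k < u) (h2 : u < l x) :
    u < l q := by
  subst hx hk
  simp only [map_add, map_smul, smul_eq_mul] at h1 h2
  by_contra hn
  push Not at hn
  have : l q ≤ l r := by
    by_contra hc; push Not at hc
    nlinarith [mul_pos hs (sub_pos.2 hc)]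
  nlinarith [mul_nonneg (sub_nonneg.2 hst.le) (sub_nonneg.2 this)]

/-- The lines from q to `f q` and from `g q` to q are the two tangents from q, directed so that the
hull is on their right. -/
theorem OuterPosition.exists_tangent_points {P C T : Finset Plane} (h : OuterPosition P C T)
    (hC : C.Nonempty) : ∃ f g : Plane → Plane, ∀ q ∈ T, f q ∈ C ∧ g q ∈ C ∧
      (∀ c ∈ C, orient q (f q) c ≤ 0) ∧ ∀ c ∈ C, orient (g q) q c ≤ 0 := by
  have : ∀ q : Plane, ∃ m m' : Plane, q ∈ T → m ∈ C ∧ m' ∈ C ∧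
      (∀ c ∈ C, orient q m c ≤ 0) ∧ ∀ c ∈ C, orient m' q c ≤ 0 := by
    intro q
    by_cases hq : q ∈ T
    · obtain ⟨v₀, v₁, hv⟩ := exists_direction (h.outside q hq)
      obtain ⟨m, hm, h1⟩ := exists_orient_nonpos hC hv
      obtain ⟨m', hm', h2⟩ := exists_orient_nonneg hC hv
      exact ⟨m, m', fun _ => ⟨hm, hm', h1, fun c hc => by rw [orient_swap]; linarith [h2 c hc]⟩⟩
    · exact ⟨q, q, fun h => absurd h hq⟩
  choose f g hfg using this
  exact ⟨f, g, hfg⟩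

/-- There are at most `4 |T|` splits of the plane, none of which contains a point of `C`, such
that two segments that cross outside of the convex hull of `C`, one of which meets the hull, can
be flipped so that one of the splits separates fewer segments. -/
theorem OuterPosition.exists_tangent_family {P C T : Finset Plane} (h : OuterPosition P C T) :
    ∃ F : Finset (Set Plane), F.card ≤ 4 * T.card ∧ (∀ H ∈ F, IsSplit H ∧ ∀ c ∈ C, c ∉ H) ∧
      ∀ a b c d x : Plane, a ∈ P → b ∈ P → c ∈ P → d ∈ P → a ≠ b → c ≠ d →
        (∀ p ∈ s(a, b), p ∉ s(c, d)) → x ∈ openSegment ℝ a b → x ∈ openSegment ℝ c d →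
        x ∉ convexHull ℝ (C : Set Plane) →
        (∃ k ∈ segment ℝ a b, k ∈ convexHull ℝ (C : Set Plane)) →
        ∃ H ∈ F, ∃ p r p' r', s(p, r) = s(a, b) ∧ s(p', r') = s(c, d) ∧
          p ∈ H ∧ p' ∈ H ∧ r ∉ H ∧ r' ∉ H := by
  classical
  by_cases hC : C.Nonempty
  swap
  · rw [Finset.not_nonempty_iff_eq_empty] at hC
    subst hC
    exact ⟨∅, by simp, by simp, by rintro a b c d x - - - - - - - - - - ⟨k, -, hk⟩; simp at hk⟩
  obtain ⟨f, g, hfg⟩ := h.exists_tangent_points hC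
  -- Each point of `T` gives two tangents, and each tangent a half-plane without and one with the
  -- point itself.
  refine ⟨T.image (fun q => leftSide q (f q) ∅) ∪ T.image (fun q => leftSide q (f q) {q}) ∪
    T.image (fun q => leftSide (g q) q ∅) ∪ T.image (fun q => leftSide (g q) q {q}), ?_, ?_, ?_⟩
  · refine (Finset.card_union_le _ _).trans ?_
    have h1 := Finset.card_union_le (T.image (fun q => leftSide q (f q) ∅) ∪
      T.image (fun q => leftSide q (f q) {q})) (T.image (fun q => leftSide (g q) q ∅))
    have h2 := Finset.card_union_le (T.image (fun q => leftSide q (f q) ∅))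
      (T.image (fun q => leftSide q (f q) {q}))
    have i1 := Finset.card_image_le (s := T) (f := fun q => leftSide q (f q) ∅)
    have i2 := Finset.card_image_le (s := T) (f := fun q => leftSide q (f q) {q})
    have i3 := Finset.card_image_le (s := T) (f := fun q => leftSide (g q) q ∅)
    have i4 := Finset.card_image_le (s := T) (f := fun q => leftSide (g q) q {q})
    omega
  · have hTC : ∀ q ∈ T, q ∉ C := fun q hq hc => Finset.disjoint_left.1 h.disjoint hc hq
    intro H hH
    simp only [Finset.mem_union, Finset.mem_image] at hH
    rcases hH with ((⟨q, hq, rfl⟩ | ⟨q, hq, rfl⟩) | ⟨q, hq, rfl⟩) | ⟨q, hq, rfl⟩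
    · refine ⟨isSplit_leftSide Set.subsingleton_empty (by simp), fun c hc => ?_⟩
      simpa [leftSide] using (hfg q hq).2.2.1 c hc
    · refine ⟨isSplit_leftSide Set.subsingleton_singleton (by simp), fun c hc => ?_⟩
      simp only [leftSide, Set.mem_ofPred_eq, Set.mem_singleton_iff, not_or, not_lt]
      exact ⟨(hfg q hq).2.2.1 c hc, fun h0 => hTC q hq (h0 ▸ hc)⟩
    · refine ⟨isSplit_leftSide Set.subsingleton_empty (by simp), fun c hc => ?_⟩
      simpa [leftSide] using (hfg q hq).2.2.2 c hc
    · refine ⟨isSplit_leftSide Set.subsingleton_singleton (by simp), fun c hc => ?_⟩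
      simp only [leftSide, Set.mem_ofPred_eq, Set.mem_singleton_iff, not_or, not_lt]
      exact ⟨(hfg q hq).2.2.2 c hc, fun h0 => hTC q hq (h0 ▸ hc)⟩
  intro a b c d x haP hbP hcP hdP hab hcd hdisj hx hx' hxK ⟨k, hk, hkK⟩
  have hTof : ∀ p, p ∈ P → p ∉ convexHull ℝ (C : Set Plane) → p ∈ T := fun p hp hpK =>
    ((h.mem_iff p).1 hp).resolve_left fun hc => hpK (subset_convexHull ℝ _ hc)
  have hsP : ∀ p, p ∈ s(a, b) → p ∈ P := by
    intro p hp; rcases Sym2.mem_iff.1 hp with rfl | rfl <;> assumption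
  have hsP' : ∀ p, p ∈ s(c, d) → p ∈ P := by
    intro p hp; rcases Sym2.mem_iff.1 hp with rfl | rfl <;> assumption
  -- The endpoint q is the one for which x lies between q and the hull point k.
  obtain ⟨q, r, hqr, s, t, hs, hst, ht, hxe, hke⟩ := exists_param_between hx hk hkK hxK
  have hq1 : q ∈ s(a, b) := by rw [← hqr]; exact Sym2.mem_mk_left _ _
  have hr1 : r ∈ s(a, b) := by rw [← hqr]; exact Sym2.mem_mk_right _ _
  have hqr0 : q ≠ r := by
    rintro rfl
    have := (Sym2.mk_isDiag_iff (x := a) (y := b)).1 (by rw [← hqr]; exact Sym2.mk_isDiag_iff.2 rfl)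
    exact hab this
  -- If cd meets the hull as well, the near endpoints q and q' are cut off together by a tangent at
  -- one of them, which must belong to the half-plane. Otherwise a tangent at one endpoint of cd
  -- cuts off q and the other endpoint of cd, and the tangent point is left out.
  by_cases hmeet : ∃ k' ∈ segment ℝ c d, k' ∈ convexHull ℝ (C : Set Plane)
  · obtain ⟨k', hk', hkK'⟩ := hmeet
    obtain ⟨q', r', hqr', s', t', hs', hst', ht', hxe', hke'⟩ :=
      exists_param_between hx' hk' hkK' hxK
    have hq1' : q' ∈ s(c, d) := by rw [← hqr']; exact Sym2.mem_mk_left _ _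
    have hr1' : r' ∈ s(c, d) := by rw [← hqr']; exact Sym2.mem_mk_right _ _
    have hqr0' : q' ≠ r' := by
      rintro rfl
      have := (Sym2.mk_isDiag_iff (x := c) (y := d)).1
        (by rw [← hqr']; exact Sym2.mk_isDiag_iff.2 rfl)
      exact hcd this
    have hqq : q ≠ q' := fun e => hdisj q hq1 (e ▸ hq1')
    have hqr'' : q ≠ r' := fun e => hdisj q hq1 (e ▸ hr1')
    have hq'r : q' ≠ r := fun e => hdisj r hr1 (e ▸ hq1')
    obtain ⟨l, u, h1, h2⟩ :=
      geometric_hahn_banach_closed_point (convex_convexHull ℝ _) (isClosed_hull C) hxK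
    have hlq := lt_of_between hs hst hxe hke (h1 k hkK) h2
    have hlq' := lt_of_between hs' hst' hxe' hke' (h1 k' hkK') h2
    have hqT := hTof q (hsP q hq1) fun hK => lt_asymm hlq (h1 q hK)
    have hqT' := hTof q' (hsP' q' hq1') fun hK => lt_asymm hlq' (h1 q' hK)
    rcases ray_misses h1 hlq.le hlq'.le with hray | hray
    · obtain ⟨f1, f2, f3, f4⟩ := hfg q hqT
      rcases h.beyond_tangent hqT hqT' hqq f1 f2 f3 hray with hp | hp
      · obtain ⟨m1, m2, m3, m4⟩ := leftSide_of_between hs hst hke hs' hst' ht' hke' hkK hkK'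
          hqr0 hqr'' (by simp) f3 hp
        refine ⟨leftSide q (f q) {q}, ?_, q, r, q', r', hqr, hqr', m1, m2, m3, m4⟩
        simp only [Finset.mem_union, Finset.mem_image]
        exact Or.inl (Or.inl (Or.inr ⟨q, hqT, rfl⟩))
      · obtain ⟨m1, m2, m3, m4⟩ := leftSide_of_between hs hst hke hs' hst' ht' hke' hkK hkK'
          hqr0 hqr'' (by simp) f4 hp
        refine ⟨leftSide (g q) q {q}, ?_, q, r, q', r', hqr, hqr', m1, m2, m3, m4⟩
        simp only [Finset.mem_union, Finset.mem_image]
        exact Or.inr ⟨q, hqT, rfl⟩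
    · obtain ⟨f1, f2, f3, f4⟩ := hfg q' hqT'
      rcases h.beyond_tangent hqT' hqT hqq.symm f1 f2 f3 hray with hp | hp
      · obtain ⟨m1, m2, m3, m4⟩ := leftSide_of_between hs' hst' hke' hs hst ht hke hkK' hkK
          hqr0' hq'r (by simp) f3 hp
        refine ⟨leftSide q' (f q') {q'}, ?_, q, r, q', r', hqr, hqr', m2, m1, m4, m3⟩
        simp only [Finset.mem_union, Finset.mem_image]
        exact Or.inl (Or.inl (Or.inr ⟨q', hqT', rfl⟩))
      · obtain ⟨m1, m2, m3, m4⟩ := leftSide_of_between hs' hst' hke' hs hst ht hke hkK' hkK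
          hqr0' hq'r (by simp) f4 hp
        refine ⟨leftSide (g q') q' {q'}, ?_, q, r, q', r', hqr, hqr', m2, m1, m4, m3⟩
        simp only [Finset.mem_union, Finset.mem_image]
        exact Or.inr ⟨q', hqT', rfl⟩
  · push Not at hmeet
    obtain ⟨l, u, v, h1, huv, h2⟩ := geometric_hahn_banach_compact_closed
      (convex_convexHull ℝ (C : Set Plane)) (C.finite_toSet.isCompact_convexHull ℝ)
      (convex_segment c d) (by
        rw [← convexHull_pair]; exact (Set.toFinite {c, d}).isClosed_convexHull ℝ)
      (Set.disjoint_left.2 fun z hz hz' => hmeet z hz' hz)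
    have key : ∀ q' r' : Plane, s(q', r') = s(c, d) →
        (∀ r : ℝ, 0 < r → q' + r • (r' - q') ∉ convexHull ℝ (C : Set Plane)) →
        ∃ H ∈ T.image (fun q => leftSide q (f q) ∅) ∪ T.image (fun q => leftSide q (f q) {q}) ∪
          T.image (fun q => leftSide (g q) q ∅) ∪ T.image (fun q => leftSide (g q) q {q}),
          ∃ p r p' r', s(p, r) = s(a, b) ∧ s(p', r') = s(c, d) ∧
          p ∈ H ∧ p' ∈ H ∧ r ∉ H ∧ r' ∉ H := by
      intro q' r' hqr' hray
      have hq1' : q' ∈ s(c, d) := by rw [← hqr']; exact Sym2.mem_mk_left _ _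
      have hr1' : r' ∈ s(c, d) := by rw [← hqr']; exact Sym2.mem_mk_right _ _
      have hqr0' : q' ≠ r' := by
        rintro rfl
        have := (Sym2.mk_isDiag_iff (x := c) (y := d)).1
          (by rw [← hqr']; exact Sym2.mk_isDiag_iff.2 rfl)
        exact hcd this
      have hqT' := hTof q' (hsP' q' hq1')
        (hmeet q' (segment_of_eq hqr' (left_mem_segment _ _ _)))
      have hrT' := hTof r' (hsP' r' hr1')
        (hmeet r' (segment_of_eq hqr' (right_mem_segment _ _ _)))
      have hx0 := openSegment_of_eq hqr'.symm hx'
      obtain ⟨f1, f2, f3, f4⟩ := hfg q' hqT'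
      -- The crossing x is beyond the tangent and k is not, so q is beyond it and r is not.
      have fin : ∀ m n : Plane, orient m n q' = 0 → (∀ c ∈ C, orient m n c ≤ 0) →
          0 < orient m n r' → q ∈ leftSide m n ∅ ∧ r' ∈ leftSide m n ∅ ∧
            r ∉ leftSide m n ∅ ∧ q' ∉ leftSide m n ∅ := by
        intro m n hq0 hC0 hr0
        obtain ⟨α, β, hα, hβ, hαβ, hxx⟩ := hx0
        have e1 : 0 < orient m n x := by
          rw [← hxx, orient_comb _ _ _ _ hαβ, hq0]; simp; positivity
        have e2 := mem_hull_orient_nonpos hC0 hkK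
        rw [hxe, orient_comb _ _ _ _ (by ring)] at e1
        rw [hke, orient_comb _ _ _ _ (by ring)] at e2
        have hQ : 0 < orient m n q := by
          by_contra hn
          push Not at hn
          have : orient m n q ≤ orient m n r := by
            by_contra hc; push Not at hc
            nlinarith [mul_pos hs (sub_pos.2 hc)]
          nlinarith [mul_nonneg (sub_nonneg.2 hst.le) (sub_nonneg.2 this)]
        refine ⟨Or.inl hQ, Or.inl hr0, ?_, ?_⟩
        · simp only [leftSide, Set.mem_ofPred_eq, Set.mem_empty_iff_false, or_false]
          intro hR
          nlinarith [mul_nonneg (show (0:ℝ) ≤ 1 - t by linarith) hQ.le,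
            mul_pos (show (0:ℝ) < t by linarith) hR]
        · simp [leftSide, hq0]
      rcases h.beyond_tangent hqT' hrT' hqr0' f1 f2 f3 hray with hp | hp
      · obtain ⟨m1, m2, m3, m4⟩ := fin q' (f q') (by simp) f3 hp
        refine ⟨leftSide q' (f q') ∅, ?_, q, r, r', q', hqr, by rw [← hqr', Sym2.eq_swap],
          m1, m2, m3, m4⟩
        simp only [Finset.mem_union, Finset.mem_image]
        exact Or.inl (Or.inl (Or.inl ⟨q', hqT', rfl⟩))
      · obtain ⟨m1, m2, m3, m4⟩ := fin (g q') q' (by simp) f4 hp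
        refine ⟨leftSide (g q') q' ∅, ?_, q, r, r', q', hqr, by rw [← hqr', Sym2.eq_swap],
          m1, m2, m3, m4⟩
        simp only [Finset.mem_union, Finset.mem_image]
        exact Or.inl (Or.inr ⟨q', hqT', rfl⟩)
    rcases ray_misses (q := c) (q' := d) h1 (huv.le.trans (h2 c (left_mem_segment _ _ _)).le)
      (huv.le.trans (h2 d (right_mem_segment _ _ _)).le) with hray | hray
    · exact key c d rfl hray
    · exact key d c Sym2.eq_swap hray

/-! ### Crossings away from the hull -/

/-- In the triangle acd, a segment joining the sides at a meets the segment from a to x. With z - a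
= α(c - a), w - a = β(d - a) and x = σc + τd, weighting z and w by σβ and ταgives a point on ax; if
both weights vanish, z or w is a. -/
theorem exists_mem_of_adjacent {a c d x z w : Plane} (hx : x ∈ segment ℝ c d)
    (hz : z ∈ segment ℝ a c) (hw : w ∈ segment ℝ a d) :
    ∃ m ∈ segment ℝ z w, m ∈ segment ℝ a x := by
  obtain ⟨σ, τ, hσ, hτ, hst, rfl⟩ := hx
  obtain ⟨α', α, hα', hα, hα1, rfl⟩ := hz
  obtain ⟨β', β, hβ', hβ, hβ1, rfl⟩ := hw
  obtain rfl : α' = 1 - α := by linarith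
  obtain rfl : β' = 1 - β := by linarith
  have h0 : 0 ≤ σ * β + τ * α := by positivity
  rcases h0.eq_or_lt with h1 | h1
  · have h2 : σ * β = 0 := by nlinarith [mul_nonneg hσ hβ, mul_nonneg hτ hα]
    have h3 : τ * α = 0 := by nlinarith [mul_nonneg hσ hβ, mul_nonneg hτ hα]
    have : α = 0 ∨ β = 0 := by
      rcases mul_eq_zero.1 h2 with e | e
      · rcases mul_eq_zero.1 h3 with e' | e'
        · linarith
        · exact Or.inl e'
      · exact Or.inr e
    rcases this with rfl | rfl
    · exact ⟨_, left_mem_segment _ _ _, by simpa using left_mem_segment ℝ a _⟩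
    · exact ⟨_, right_mem_segment _ _ _, by simpa using left_mem_segment ℝ a _⟩
  · refine ⟨_, ⟨σ * β / (σ * β + τ * α), τ * α / (σ * β + τ * α), by positivity, by positivity,
      by field_simp, rfl⟩, (σ * β * (1 - α) + τ * α * (1 - β)) / (σ * β + τ * α),
      α * β / (σ * β + τ * α), by positivity, by positivity, ?_, ?_⟩
    · rw [← add_div, div_eq_one_iff_eq h1.ne']; linear_combination (-α * β) * hst
    · apply plane_ext <;> simp <;> field_simp <;> ring

/-- Comparing the two expressions for x shows that positive multiples of the two orientations sum to
zero. -/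
theorem orient_of_cross {p r p' r' x : Plane} (hx : x ∈ openSegment ℝ p r)
    (hx' : x ∈ openSegment ℝ p' r') (h : orient p r p' < 0) : 0 < orient p' r' p := by
  obtain ⟨α, β, hα, hβ, hs, rfl⟩ := hx
  obtain ⟨γ, δ, hγ, hδ, hs', he⟩ := hx'
  obtain rfl : α = 1 - β := by linarith
  obtain rfl : γ = 1 - δ := by linarith
  have e0 := congrArg (fun z : Plane => z 0) he
  have e1 := congrArg (fun z : Plane => z 1) he
  simp only [comb_apply] at e0 e1
  have : β * orient p r p' + δ * orient p' r' p = 0 := by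
    simp only [orient]
    linear_combination (p 1 - p' 1) * e0 - (p 0 - p' 0) * e1
  by_contra hn
  push Not at hn
  nlinarith [mul_pos hβ (neg_pos.2 h), mul_nonneg hδ.le (neg_nonneg.2 hn)]

/-- Every flip of two crossing segments is an advantage for one of the half-planes bounded by the
lines of the removed segments. -/
theorem exists_leftSide {p r p' r' x : Plane} (hx : x ∈ openSegment ℝ p r)
    (hx' : x ∈ openSegment ℝ p' r') (h : orient p r p' ≠ 0) :
    ∃ u ∈ ({p, p'} : Set Plane), ∃ v ∈ ({r, r'} : Set Plane),
      p ∈ leftSide u v {u} ∧ p' ∈ leftSide u v {u} ∧ r ∉ leftSide u v {u} ∧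
      r' ∉ leftSide u v {u} := by
  have hopp := orient_opposite hx hx' h
  have hpr : p ≠ r := by rintro rfl; simp at h
  have hpr' : p ≠ r' := by rintro rfl; simp at hopp
  have hpp' : p' ≠ r := by rintro rfl; simp at h
  have hrr' : p' ≠ r' := by rintro rfl; nlinarith [sq_nonneg (orient p r p')]
  rcases lt_or_gt_of_ne h with h1 | h1
  · have h2 := orient_of_cross hx hx' h1
    have h3 := orient_opposite hx' hx h2.ne'
    refine ⟨p', by simp, r', by simp, Or.inl h2, Or.inr rfl, ?_, ?_⟩
    · rintro (h4 | h4)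
      · nlinarith
      · exact hpp' h4.symm
    · rintro (h4 | h4)
      · simp at h4
      · exact hrr' h4.symm
  · refine ⟨p, by simp, r, by simp, Or.inr rfl, Or.inl h1, ?_, ?_⟩
    · rintro (h4 | h4)
      · simp at h4
      · exact hpr h4.symm
    · rintro (h4 | h4)
      · nlinarith
      · exact hpr' h4.symm

/-- If a convex set misses two crossing segments, then it misses both segments of one of the two
possible insertions. -/
theorem exists_insertion_misses {K : Set Plane} (hK : Convex ℝ K) {a b c d x : Plane}
    (hx : x ∈ openSegment ℝ a b) (hx' : x ∈ openSegment ℝ c d)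
    (h1 : ∀ z ∈ segment ℝ a b, z ∉ K) (h2 : ∀ z ∈ segment ℝ c d, z ∉ K) :
    ((∀ z ∈ segment ℝ a c, z ∉ K) ∧ ∀ z ∈ segment ℝ b d, z ∉ K) ∨
    ((∀ z ∈ segment ℝ a d, z ∉ K) ∧ ∀ z ∈ segment ℝ b c, z ∉ K) := by
  have hab := openSegment_subset_segment ℝ a b hx
  have hcd := openSegment_subset_segment ℝ c d hx'
  -- If both insertions hit K, then two hit segments, one of each insertion, share an endpoint a'.
  -- By convexity K then meets the part of a removed segment between a' and x.
  have key : ∀ {a' c' d' z w : Plane}, x ∈ segment ℝ c' d' →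
      (∀ m ∈ segment ℝ a' x, m ∉ K) → z ∈ segment ℝ a' c' → w ∈ segment ℝ a' d' → z ∈ K →
      w ∈ K → False := by
    intro a' c' d' z w hx0 hm hz hw hzK hwK
    obtain ⟨m, hm1, hm2⟩ := exists_mem_of_adjacent hx0 hz hw
    exact hm m hm2 (hK.segment_subset hzK hwK hm1)
  have sub : ∀ {a b : Plane}, x ∈ segment ℝ a b → (∀ z ∈ segment ℝ a b, z ∉ K) →
      ∀ m ∈ segment ℝ a x, m ∉ K := fun hx0 h m hm =>
    h m ((convex_segment _ _).segment_subset (left_mem_segment _ _ _) hx0 hm)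
  have hba : x ∈ segment ℝ b a := by rwa [segment_symm]
  have hdc : x ∈ segment ℝ d c := by rwa [segment_symm]
  have h1' : ∀ z ∈ segment ℝ b a, z ∉ K := by rwa [segment_symm]
  have h2' : ∀ z ∈ segment ℝ d c, z ∉ K := by rwa [segment_symm]
  by_contra hn
  rw [not_or, not_and_or, not_and_or] at hn
  push Not at hn
  obtain ⟨⟨z, hz, hzK⟩ | ⟨z, hz, hzK⟩, ⟨w, hw, hwK⟩ | ⟨w, hw, hwK⟩⟩ := hn
  · exact key hcd (sub hab h1) hz hw hzK hwK
  · rw [segment_symm] at hz hw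
    exact key hab (sub hcd h2) hz hw hzK hwK
  · rw [segment_symm] at hz hw
    exact key hba (sub hdc h2') hz hw hzK hwK
  · exact key hdc (sub hba h1') hz hw hzK hwK

/-! ### Matchings and flip paths -/

/-- The vertices of the flip graph of perfect matchings. -/
def Valid (P : Finset Plane) (n : ℕ) (S : Multiset Seg) : Prop :=
  S.card = n ∧ (∀ s ∈ S, ¬ s.IsDiag ∧ ∀ p ∈ s, p ∈ P) ∧ IsPerfectMatching P S

theorem segDegree_cons (s : Seg) (S : Multiset Seg) (p : Plane) [Decidable (p ∈ s)] :
    segDegree (s ::ₘ S) p = segDegree S p + if p ∈ s then 1 else 0 := by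
  classical
  simp only [segDegree, Multiset.countP_cons]
  congr

theorem segDegree_flip {a b c d : Plane} (hab : a ≠ b) (hcd : c ≠ d) (hac : a ≠ c) (hbd : b ≠ d)
    (R : Multiset Seg) (p : Plane) :
    segDegree (s(a, c) ::ₘ s(b, d) ::ₘ R) p = segDegree (s(a, b) ::ₘ s(c, d) ::ₘ R) p := by
  classical
  simp only [segDegree_cons, Sym2.mem_iff, add_assoc, add_right_inj]
  by_cases h1 : p = a <;> by_cases h2 : p = b <;> by_cases h3 : p = c <;> by_cases h4 : p = d <;>
    simp_all

theorem Valid.flip {P : Finset Plane} {n : ℕ} {S S' : Multiset Seg} (hS : Valid P n S)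
    (h : IsFlip S S') : Valid P n S' := by
  obtain ⟨a, b, c, d, R, rfl, rfl, hc, -⟩ := h
  obtain ⟨h1, h2, h3⟩ := hS
  have hab := h2 s(a, b) (by simp)
  have hcd := h2 s(c, d) (by simp)
  have hac : a ≠ c := fun e => hc.disjoint (p := a) (by simp) (by simp [e])
  have hbd : b ≠ d := fun e => hc.disjoint (p := b) (by simp) (by simp [e])
  refine ⟨by simpa using h1, ?_, fun p hp => ?_⟩
  · intro s hs
    simp only [Multiset.mem_cons] at hs
    rcases hs with rfl | rfl | hs
    · refine ⟨by simpa using hac, fun p hp => ?_⟩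
      rcases Sym2.mem_iff.1 hp with rfl | rfl
      · exact hab.2 _ (by simp)
      · exact hcd.2 _ (by simp)
    · refine ⟨by simpa using hbd, fun p hp => ?_⟩
      rcases Sym2.mem_iff.1 hp with rfl | rfl
      · exact hab.2 _ (by simp)
      · exact hcd.2 _ (by simp)
    · exact h2 s (by simp [hs])
  · rw [segDegree_flip (by simpa using hab.1) (by simpa using hcd.1) hac hbd]
    exact h3 p hp

/-- Different segments of a perfect matching have no endpoint in common. -/
theorem Valid.disjoint {P : Finset Plane} {n : ℕ} {s₁ s₂ : Seg} {R : Multiset Seg}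
    (hS : Valid P n (s₁ ::ₘ s₂ ::ₘ R)) {p : Plane} (h1 : p ∈ s₁) : p ∉ s₂ := by
  classical
  intro h2
  have := hS.2.2 p ((hS.2.1 s₁ (by simp)).2 p h1)
  simp [segDegree_cons, h1, h2] at this

theorem Crossing.ne {s₁ s₂ : Seg} (h : Crossing s₁ s₂) : s₁ ≠ s₂ := by
  rintro rfl
  induction s₁ using Sym2.ind with
  | _ a b => exact h.disjoint (p := a) (by simp) (by simp)

theorem exists_cons_cons {S : Multiset Seg} {s₁ s₂ : Seg} (h1 : s₁ ∈ S) (h2 : s₂ ∈ S)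
    (h : s₁ ≠ s₂) : ∃ R, S = s₁ ::ₘ s₂ ::ₘ R := by
  obtain ⟨R, rfl⟩ := Multiset.exists_cons_of_mem h1
  obtain ⟨R', rfl⟩ := Multiset.exists_cons_of_mem ((Multiset.mem_cons.1 h2).resolve_left h.symm)
  exact ⟨R', rfl⟩

/-- Crossing segments with endpoints in general position. -/
theorem Crossing.orient_ne_zero {P : Finset Plane} (hP : GeneralPosition P) {a b c d : Plane}
    (h : Crossing s(a, b) s(c, d)) (ha : a ∈ P) (hb : b ∈ P) (hc : c ∈ P) (hab : a ≠ b) :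
    orient a b c ≠ 0 :=
  hP.orient_ne_zero ha hb hc hab (fun e => h.disjoint (p := a) (by simp) (by simp [e]))
    (fun e => h.disjoint (p := b) (by simp) (by simp [e]))

/-- Both insertion choices are available for each pair of crossing segments. -/
theorem Valid.isFlip {P : Finset Plane} (hP : GeneralPosition P) {n : ℕ} {a b c d : Plane}
    {R : Multiset Seg} (hS : Valid P n (s(a, b) ::ₘ s(c, d) ::ₘ R))
    (h : Crossing s(a, b) s(c, d)) :
    IsFlip (s(a, b) ::ₘ s(c, d) ::ₘ R) (s(a, c) ::ₘ s(b, d) ::ₘ R) := by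
  refine ⟨a, b, c, d, R, rfl, rfl, h, ?_⟩
  have h1 := hS.2.1 s(a, b) (by simp)
  have h2 := hS.2.1 s(c, d) (by simp)
  obtain ⟨x, hx, hx'⟩ := h.exists_mem
  exact not_crossing_flip hx hx' (h.orient_ne_zero hP (h1.2 _ (by simp)) (h1.2 _ (by simp))
    (h2.2 _ (by simp)) (by simpa using h1.1))

/-- `S'` is reached from `S` by `k` flips. -/
inductive FlipPath : ℕ → Multiset Seg → Multiset Seg → Prop
  | refl (S : Multiset Seg) : FlipPath 0 S S
  | step {k : ℕ} {S S' S'' : Multiset Seg} : IsFlip S S' → FlipPath k S' S'' →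
      FlipPath (k + 1) S S''

theorem FlipPath.trans {k l : ℕ} {S S' S'' : Multiset Seg} (h : FlipPath k S S')
    (h' : FlipPath l S' S'') : FlipPath (k + l) S S'' := by
  induction h with
  | refl => simpa using h'
  | step hf _ ih => rw [Nat.add_right_comm]; exact .step hf (ih h')

theorem FlipPath.single {S S' : Multiset Seg} (h : IsFlip S S') : FlipPath 1 S S' :=
  .step h (.refl _)

theorem Valid.flipPath {P : Finset Plane} {n k : ℕ} {S S' : Multiset Seg} (hS : Valid P n S)
    (h : FlipPath k S S') : Valid P n S' := by
  induction h with
  | refl => exact hS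
  | step hf _ ih => exact ih (hS.flip hf)

/-! ### Potentials -/

/-- The segment `s` meets the convex hull of `C`. -/
def Hits (C : Finset Plane) (s : Seg) : Prop := ∃ z ∈ s.carrier, z ∈ convexHull ℝ (C : Set Plane)

/-- The segment `s` meets the convex hull of `C` at most in its endpoints. -/
def Settled (C : Finset Plane) (s : Seg) : Prop :=
  ∀ z ∈ s.carrier, z ∈ convexHull ℝ (C : Set Plane) → z ∈ s

open Classical in
/-- The number of endpoints of `s` in `T`. -/
noncomputable def endCount (T : Finset Plane) (s : Seg) : ℕ := (T.filter (· ∈ s)).card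

open Classical in
/-- The number of endpoints in `T` of a segment that is not settled. -/
noncomputable def unsettledCount (C T : Finset Plane) (s : Seg) : ℕ :=
  if Settled C s then 0 else endCount T s

open Classical in
/-- The number of sets in the family `F` that separate the endpoints of `s`. -/
noncomputable def sepCount (F : Finset (Set Plane)) (s : Seg) : ℕ :=
  (F.filter (Separates · s)).card

/-- The potential of a segment that decreases in the flips which cannot be repeated often. -/
noncomputable def energy (F : Finset (Set Plane)) (C T : Finset Plane) (s : Seg) : ℕ :=
  5 * sepCount F s + unsettledCount C T s

open Classical in
/-- The potential of a segment that decreases in flips far from the convex hull of `C`. -/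
noncomputable def freeCount (F : Finset (Set Plane)) (C : Finset Plane) (s : Seg) : ℕ :=
  if Hits C s then 0 else sepCount F s

/-- The sum of a weight over the segments of a multiset. -/
def total (w : Seg → ℕ) (S : Multiset Seg) : ℕ := (S.map w).sum

@[simp] theorem total_cons (w : Seg → ℕ) (s : Seg) (S : Multiset Seg) :
    total w (s ::ₘ S) = w s + total w S := by simp [total]

theorem total_le_total {w w' : Seg → ℕ} {S : Multiset Seg} (h : ∀ s ∈ S, w s ≤ w' s) :
    total w S ≤ total w' S := Multiset.sum_map_le_sum_map _ _ h

theorem total_mul (k : ℕ) (w : Seg → ℕ) (S : Multiset Seg) :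
    total (fun s => k * w s) S = k * total w S := by simp [total, Multiset.sum_map_mul_left]

theorem endCount_mk {T : Finset Plane} {a b : Plane} (hab : a ≠ b)
    [Decidable (a ∈ T)] [Decidable (b ∈ T)] :
    endCount T s(a, b) = (if a ∈ T then 1 else 0) + (if b ∈ T then 1 else 0) := by
  classical
  have : T.filter (· ∈ s(a, b)) = T.filter (· = a) ∪ T.filter (· = b) := by
    ext p; simp [Finset.mem_filter, Finset.mem_union, and_or_left]
  rw [endCount, this, Finset.card_union_of_disjoint, Finset.filter_eq', Finset.filter_eq']
  · split_ifs <;> simp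
  · rw [Finset.disjoint_left]
    intro p hp hp'
    simp only [Finset.mem_filter] at hp hp'
    exact hab (hp.2.symm.trans hp'.2)

theorem endCount_le_two {T : Finset Plane} {s : Seg} (hs : ¬ s.IsDiag) : endCount T s ≤ 2 := by
  classical
  induction s using Sym2.ind with
  | _ a b =>
    rw [endCount_mk (by simpa using hs)]
    split_ifs <;> simp

theorem unsettledCount_le (C T : Finset Plane) (s : Seg) :
    unsettledCount C T s ≤ endCount T s := by
  rw [unsettledCount]; split_ifs <;> simp

theorem unsettledCount_of_settled {C T : Finset Plane} {s : Seg} (h : Settled C s) :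
    unsettledCount C T s = 0 := by rw [unsettledCount, if_pos h]

theorem unsettledCount_of_mem {C T : Finset Plane} {a b x : Plane} (hab : a ≠ b)
    (hx : x ∈ openSegment ℝ a b) (hK : x ∈ convexHull ℝ (C : Set Plane)) :
    unsettledCount C T s(a, b) = endCount T s(a, b) := by
  rw [unsettledCount, if_neg]
  intro h
  rcases Sym2.mem_iff.1 (h x (openSegment_subset_segment _ _ _ hx) hK) with rfl | rfl
  · exact hab (left_mem_openSegment_iff.1 hx)
  · exact hab (right_mem_openSegment_iff.1 hx)

theorem settled_of_not_hits {C : Finset Plane} {s : Seg} (h : ¬ Hits C s) : Settled C s :=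
  fun z hz hK => absurd ⟨z, hz, hK⟩ h

theorem hits_of_mem {C : Finset Plane} {a b x : Plane} (hx : x ∈ openSegment ℝ a b)
    (hK : x ∈ convexHull ℝ (C : Set Plane)) : Hits C s(a, b) :=
  ⟨x, openSegment_subset_segment _ _ _ hx, hK⟩

theorem hits_of_mem_left {C : Finset Plane} {a b : Plane} (ha : a ∈ C) : Hits C s(a, b) :=
  ⟨a, left_mem_segment _ _ _, subset_convexHull ℝ _ ha⟩

theorem hits_of_mem_right {C : Finset Plane} {a b : Plane} (hb : b ∈ C) : Hits C s(a, b) :=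
  ⟨b, right_mem_segment _ _ _, subset_convexHull ℝ _ hb⟩

theorem OuterPosition.endCount_of_not_hits {P C T : Finset Plane} (h : OuterPosition P C T)
    {a b : Plane} (ha : a ∈ P) (hb : b ∈ P) (hab : a ≠ b) (hs : ¬ Hits C s(a, b)) :
    endCount T s(a, b) = 2 := by
  classical
  have ha' : a ∈ T := ((h.mem_iff a).1 ha).resolve_left fun hc => hs (hits_of_mem_left hc)
  have hb' : b ∈ T := ((h.mem_iff b).1 hb).resolve_left fun hc => hs (hits_of_mem_right hc)
  rw [endCount_mk hab, if_pos ha', if_pos hb']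

theorem endCount_flip {T : Finset Plane} {a b c d : Plane} (hab : a ≠ b) (hcd : c ≠ d)
    (hac : a ≠ c) (hbd : b ≠ d) :
    endCount T s(a, c) + endCount T s(b, d) = endCount T s(a, b) + endCount T s(c, d) := by
  classical
  rw [endCount_mk hab, endCount_mk hcd, endCount_mk hac, endCount_mk hbd]; omega

theorem sepCount_flip {F : Finset (Set Plane)} (hF : ∀ H ∈ F, IsSplit H) {a b c d x : Plane}
    (hx : x ∈ openSegment ℝ a b) (hx' : x ∈ openSegment ℝ c d) (hab : a ≠ b) (hcd : c ≠ d) :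
    sepCount F s(a, c) + sepCount F s(b, d) ≤ sepCount F s(a, b) + sepCount F s(c, d) := by
  classical
  simp only [sepCount, Finset.card_filter, ← Finset.sum_add_distrib]
  refine Finset.sum_le_sum fun H hH => ?_
  obtain ⟨h1, h2⟩ := separates_flip (hF H hH) hx hx' hab hcd
  split_ifs <;> first | omega | (exfalso; tauto)

theorem sepCount_flip_lt {F : Finset (Set Plane)} (hF : ∀ H ∈ F, IsSplit H) {a b c d x : Plane}
    (hx : x ∈ openSegment ℝ a b) (hx' : x ∈ openSegment ℝ c d) (hab : a ≠ b) (hcd : c ≠ d)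
    {H : Set Plane} (hH : H ∈ F) (ha : a ∈ H) (hc : c ∈ H) (hb : b ∉ H) (hd : d ∉ H) :
    sepCount F s(a, c) + sepCount F s(b, d) < sepCount F s(a, b) + sepCount F s(c, d) := by
  classical
  simp only [sepCount, Finset.card_filter, ← Finset.sum_add_distrib]
  refine Finset.sum_lt_sum (fun H hH => ?_) ⟨H, hH, ?_⟩
  · obtain ⟨h1, h2⟩ := separates_flip (hF H hH) hx hx' hab hcd
    split_ifs <;> first | omega | (exfalso; tauto)
  · simp [separates_mk, ha, hb, hc, hd]

/-- A family of splits as provided by `OuterPosition.exists_tangent_family`. -/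
structure TangentFamily (P C : Finset Plane) (F : Finset (Set Plane)) : Prop where
  split : ∀ H ∈ F, IsSplit H
  avoids : ∀ H ∈ F, ∀ c ∈ C, c ∉ H
  tangent : ∀ a b c d x : Plane, a ∈ P → b ∈ P → c ∈ P → d ∈ P → a ≠ b → c ≠ d →
    (∀ p ∈ s(a, b), p ∉ s(c, d)) → x ∈ openSegment ℝ a b → x ∈ openSegment ℝ c d →
    x ∉ convexHull ℝ (C : Set Plane) →
    (∃ k ∈ segment ℝ a b, k ∈ convexHull ℝ (C : Set Plane)) →
    ∃ H ∈ F, ∃ p r p' r', s(p, r) = s(a, b) ∧ s(p', r') = s(c, d) ∧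
      p ∈ H ∧ p' ∈ H ∧ r ∉ H ∧ r' ∉ H

/-! ### Flips that lower the energy -/

section Events

variable {P C T : Finset Plane} {F : Finset (Set Plane)} {n : ℕ}

/-- Two crossing segments of a matching have four different endpoints. -/
theorem Crossing.four_ne {a b c d : Plane} (hc : Crossing s(a, b) s(c, d)) :
    a ≠ c ∧ a ≠ d ∧ b ≠ c ∧ b ≠ d :=
  ⟨fun e => hc.disjoint (p := a) (by simp) (by simp [e]),
    fun e => hc.disjoint (p := a) (by simp) (by simp [e]),
    fun e => hc.disjoint (p := b) (by simp) (by simp [e]),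
    fun e => hc.disjoint (p := b) (by simp) (by simp [e])⟩

theorem Valid.ne {a b : Plane} {S : Multiset Seg} (hS : Valid P n S) (h : s(a, b) ∈ S) : a ≠ b := by
  simpa using (hS.2.1 _ h).1

theorem Valid.mem_left {a b : Plane} {S : Multiset Seg} (hS : Valid P n S) (h : s(a, b) ∈ S) :
    a ∈ P := (hS.2.1 _ h).2 _ (by simp)

theorem Valid.mem_right {a b : Plane} {S : Multiset Seg} (hS : Valid P n S) (h : s(a, b) ∈ S) :
    b ∈ P := (hS.2.1 _ h).2 _ (by simp)

/-- Two segments that cross outside of the convex hull of `C`, one of which meets the hull, can be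
flipped with a decrease of the energy. -/
theorem OuterPosition.event_outside (h : OuterPosition P C T) (hF : TangentFamily P C F)
    {a b c d x : Plane} {S : Multiset Seg} (hS : Valid P n S)
    (h1 : s(a, b) ∈ S) (h2 : s(c, d) ∈ S) (hc : Crossing s(a, b) s(c, d))
    (hx : x ∈ openSegment ℝ a b) (hx' : x ∈ openSegment ℝ c d)
    (hxK : x ∉ convexHull ℝ (C : Set Plane)) (hhit : Hits C s(a, b)) :
    ∃ S', IsFlip S S' ∧ total (energy F C T) S' < total (energy F C T) S := by
  obtain ⟨R, rfl⟩ := exists_cons_cons h1 h2 hc.ne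
  obtain ⟨H, hH, p, r, p', r', e1, e2, m1, m2, m3, m4⟩ := hF.tangent a b c d x (hS.mem_left h1)
    (hS.mem_right h1) (hS.mem_left h2) (hS.mem_right h2) (hS.ne h1) (hS.ne h2)
    (fun p hp => hc.disjoint hp) hx hx' hxK hhit
  have hx0 := openSegment_of_eq e1.symm hx
  have hx0' := openSegment_of_eq e2.symm hx'
  rw [← e1, ← e2] at hS hc h1 h2 ⊢
  have hf := hS.isFlip h.general hc
  refine ⟨_, hf, ?_⟩
  have hlt := sepCount_flip_lt hF.split hx0 hx0' (hS.ne h1) (hS.ne h2) hH m1 m2 m3 m4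
  have hv := hS.flip hf
  -- The inserted segments have at most four unsettled endpoints in total; the factor 5 makes one
  -- lost separation outweigh them.
  have u1 := (unsettledCount_le C T s(p, p')).trans (endCount_le_two (hv.2.1 s(p, p') (by simp)).1)
  have u2 := (unsettledCount_le C T s(r, r')).trans (endCount_le_two (hv.2.1 s(r, r') (by simp)).1)
  simp only [total_cons, energy]
  omega

/-- Flipping two segments that cross in the convex hull of `C` does not increase the energy. -/
theorem energy_flip_le (hF : TangentFamily P C F) {a b c d x : Plane}
    (hab : a ≠ b) (hcd : c ≠ d) (hc : Crossing s(a, b) s(c, d))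
    (hx : x ∈ openSegment ℝ a b) (hx' : x ∈ openSegment ℝ c d)
    (hxK : x ∈ convexHull ℝ (C : Set Plane)) :
    energy F C T s(a, c) + energy F C T s(b, d) ≤ energy F C T s(a, b) + energy F C T s(c, d) := by
  have h1 := sepCount_flip hF.split hx hx' hab hcd
  have h2 := endCount_flip (T := T) hab hcd hc.four_ne.1 hc.four_ne.2.2.2
  -- Both removed segments have x in their interior and are unsettled, so all their endpoints in `T`
  -- are already counted.
  have h3 := unsettledCount_of_mem (T := T) hab hx hxK
  have h4 := unsettledCount_of_mem (T := T) hcd hx' hxK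
  have u1 := unsettledCount_le C T s(a, c)
  have u2 := unsettledCount_le C T s(b, d)
  simp only [energy]
  omega

/-- Both removed segments count all their endpoints in `T`, whereas the settled inserted segment
counts none of its own. -/
theorem energy_flip_lt (hF : TangentFamily P C F) {a b c d x : Plane}
    (hab : a ≠ b) (hcd : c ≠ d) (hc : Crossing s(a, b) s(c, d))
    (hx : x ∈ openSegment ℝ a b) (hx' : x ∈ openSegment ℝ c d)
    (hxK : x ∈ convexHull ℝ (C : Set Plane)) (hset : Settled C s(a, c))
    (hend : 0 < endCount T s(a, c)) :
    energy F C T s(a, c) + energy F C T s(b, d) < energy F C T s(a, b) + energy F C T s(c, d) := by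
  have h1 := sepCount_flip hF.split hx hx' hab hcd
  have h2 := endCount_flip (T := T) hab hcd hc.four_ne.1 hc.four_ne.2.2.2
  have h3 := unsettledCount_of_mem (T := T) hab hx hxK
  have h4 := unsettledCount_of_mem (T := T) hcd hx' hxK
  have u1 := unsettledCount_of_settled (T := T) hset
  have u2 := unsettledCount_le C T s(b, d)
  simp only [energy]
  omega

/-- If `e` is visible from `p`, then a flip that inserts `pe` decreases the energy. -/
theorem OuterPosition.event_visible (h : OuterPosition P C T) (hF : TangentFamily P C F)
    {p b e f v : Plane} {S : Multiset Seg} (hS : Valid P n S)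
    (h1 : s(p, b) ∈ S) (h2 : s(e, f) ∈ S) (hc : Crossing s(p, b) s(e, f))
    (hv : v ∈ openSegment ℝ p b) (hv' : v ∈ openSegment ℝ e f)
    (hvK : v ∈ convexHull ℝ (C : Set Plane))
    (hvis : ∀ z ∈ convexHull ℝ (C : Set Plane), z ∈ segment ℝ p e → z = e) :
    ∃ S', IsFlip S S' ∧ total (energy F C T) S' < total (energy F C T) S := by
  classical
  obtain ⟨R, rfl⟩ := exists_cons_cons h1 h2 hc.ne
  refine ⟨_, hS.isFlip h.general hc, ?_⟩
  have hpe := hc.four_ne.1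
  have hpT : p ∈ T := ((h.mem_iff p).1 (hS.mem_left h1)).resolve_left fun hpC =>
    hpe (hvis p (subset_convexHull ℝ _ hpC) (left_mem_segment _ _ _))
  have hset : Settled C s(p, e) := fun z hz hzK => by
    rw [hvis z hzK hz]; simp
  have hend : 0 < endCount T s(p, e) := by
    rw [endCount_mk hpe, if_pos hpT]; omega
  have := energy_flip_lt hF (hS.ne h1) (hS.ne h2) hc hv hv' hvK hset hend
  simp only [total_cons]
  omega

/-- If a segment enters the triangle `pbx` through the side `pb` and does not leave it, then there
is a flip that decreases the energy. -/
theorem OuterPosition.event_triangle (h : OuterPosition P C T) (hF : TangentFamily P C F)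
    {p b x e f v : Plane} {S : Multiset Seg} (hS : Valid P n S)
    (h1 : s(p, b) ∈ S) (h2 : s(e, f) ∈ S) (hc : Crossing s(p, b) s(e, f))
    (hv : v ∈ openSegment ℝ p b) (hv' : v ∈ openSegment ℝ e f)
    (hvK : v ∈ convexHull ℝ (C : Set Plane)) (hxK : x ∈ convexHull ℝ (C : Set Plane))
    (hpbx : orient p b x ≠ 0)
    (hout : ∀ w ∈ segment ℝ e f, ¬ (w ∈ openSegment ℝ p x ∨ w ∈ openSegment ℝ x b ∨ w = x)) :
    ∃ S', IsFlip S S' ∧ total (energy F C T) S' < total (energy F C T) S := by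
  have hpbe := hc.orient_ne_zero h.general (hS.mem_left h1) (hS.mem_right h1) (hS.mem_left h2)
    (hS.ne h1)
  rcases pasch hv hv' hpbx hpbe with ⟨w, hw, hw'⟩ | ⟨g, g', hg, α, β, γ, hα, hβ, hγ, hs, hge⟩
  · exact absurd hw' (hout w hw)
  · have hvg := openSegment_of_eq hg.symm hv'
    rw [← hg] at h2 hc
    rcases h.visible (hS.mem_left h2) hxK hα hβ hγ hs hge with hvis | hvis
    · exact h.event_visible hF hS h1 h2 hc hv hvg hvK hvis
    · rw [Sym2.eq_swap] at h1 hc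
      rw [openSegment_symm] at hv
      exact h.event_visible hF hS h1 h2 hc hv hvg hvK hvis

end Events

/-! ### Adding a segment to the crossing-free part -/

section Insertion

variable {P C T : Finset Plane} {F F' : Finset (Set Plane)} {n : ℕ}

/-- By general position w is not in `P`, so it is interior to both segments, and these share no
endpoint. -/
theorem crossing_of_meets (hP : GeneralPosition P) {a b e f w : Plane} {S : Multiset Seg}
    (hS : Valid P n S) (h1 : s(a, b) ∈ S) (h2 : s(e, f) ∈ S) (hne : s(a, b) ≠ s(e, f))
    (hw : w ∈ segment ℝ e f) (hw' : w ∈ openSegment ℝ a b) : Crossing s(a, b) s(e, f) := by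
  obtain ⟨R, rfl⟩ := exists_cons_cons h1 h2 hne
  have hnot := not_mem_of_mem_openSegment hP (hS.mem_left h1) (hS.mem_right h1) (hS.ne h1) hw'
  have he := hS.mem_left h2
  have hf := hS.mem_right h2
  have hwo : w ∈ openSegment ℝ e f := mem_openSegment_of_ne_left_right
    (fun hh => hnot (hh ▸ he)) (fun hh => hnot (hh ▸ hf)) hw
  have hae : a ≠ e := fun hh => hS.disjoint (p := a) (by simp) (by simp [hh])
  have hbe : b ≠ e := fun hh => hS.disjoint (p := b) (by simp) (by simp [hh])
  exact crossing_of_mem hw' hwo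
    (hP.orient_ne_zero (hS.mem_left h1) (hS.mem_right h1) he (hS.ne h1) hae hbe)

/-- If a segment `pb` inserted by a flip at `x` crosses a segment that stays away from `px` and
from the removed segment at `b`, then the next flip can decrease the energy. -/
theorem OuterPosition.event_inserted (h : OuterPosition P C T) (hF : TangentFamily P C F)
    {p r a b x : Plane} {R : Multiset Seg} (hS : Valid P n (s(p, r) ::ₘ s(b, a) ::ₘ R))
    (hc : Crossing s(p, r) s(b, a)) (hx : x ∈ openSegment ℝ p r) (hx' : x ∈ openSegment ℝ b a)
    (hxK : x ∈ convexHull ℝ (C : Set Plane)) {ρ : Seg} (hρ : ρ ∈ R)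
    (hcρ : Crossing s(p, b) ρ) (hhit : Hits C s(p, b)) (hσ : ¬ Crossing s(b, a) ρ)
    (hclose : ∀ w ∈ ρ.carrier, w ∉ openSegment ℝ p x) :
    ∃ S', IsFlip (s(p, b) ::ₘ s(r, a) ::ₘ R) S' ∧
      total (energy F C T) S' < total (energy F C T) (s(p, b) ::ₘ s(r, a) ::ₘ R) := by
  have hS1 := hS.flip (hS.isFlip h.general hc)
  induction ρ using Sym2.ind with
  | _ e f =>
  obtain ⟨v, hv, hv'⟩ := hcρ.exists_mem
  have m1 : s(p, b) ∈ s(p, b) ::ₘ s(r, a) ::ₘ R := by simp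
  have m2 : s(e, f) ∈ s(p, b) ::ₘ s(r, a) ::ₘ R := by simp [hρ]
  by_cases hvK : v ∈ convexHull ℝ (C : Set Plane)
  swap
  · exact h.event_outside hF hS1 m1 m2 hcρ hv hv' hvK hhit
  have hp : p ∈ P := hS.mem_left (b := r) (by simp)
  have hr : r ∈ P := hS.mem_right (a := p) (by simp)
  have hb : b ∈ P := hS.mem_left (b := a) (by simp)
  have hpr : p ≠ r := hS.ne (by simp)
  have hpbx : orient p b x ≠ 0 := by
    obtain ⟨α, β, hα, hβ, hs, rfl⟩ := hx
    rw [orient_comb _ _ _ _ hs]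
    have := h.general.orient_ne_zero hp hb hr hc.four_ne.1 hpr hc.four_ne.2.2.1.symm
    simp [this, hβ.ne']
  have hne : s(b, a) ≠ s(e, f) :=
    fun hh => hcρ.disjoint (p := b) (by simp) (by simp [← hh])
  have meet : ∀ w ∈ segment ℝ e f, w ∈ openSegment ℝ b a → False := fun w hw hw' =>
    hσ (crossing_of_meets h.general hS (by simp) (by simp [hρ]) hne hw hw')
  -- The segment ef cannot leave the triangle pbx: px is excluded by `hclose`, and xb is part of ba,
  -- which ef does not meet.
  refine h.event_triangle hF hS1 m1 m2 hcρ hv hv' hvK hxK hpbx fun w hw hor => ?_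
  rcases hor with h1 | h1 | rfl
  · exact hclose w hw h1
  · refine meet w hw ?_
    obtain ⟨α, β, hα, hβ, hs, rfl⟩ := hx'
    obtain ⟨γ, δ, hγ, hδ, hs', rfl⟩ := h1
    refine ⟨γ * α + δ, γ * β, by positivity, by positivity, ?_, ?_⟩
    · linear_combination γ * hs + hs'
    · apply plane_ext <;> simp <;> ring
  · exact meet w hw hx'

open Classical in
/-- The number of segments that meet the hull of `C` but are not in `G`. -/
noncomputable def pending (C : Finset Plane) (S G : Multiset Seg) : ℕ :=
  S.countP (Hits C) - G.card

/-- A part of the matching consisting of pairwise non-crossing segments that meet the hull. -/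
structure Clean (C : Finset Plane) (S G : Multiset Seg) : Prop where
  le : G ≤ S
  hits : ∀ s ∈ G, Hits C s
  free : CrossingFree G

theorem Clean.mono {S S' G G' : Multiset Seg} (h : Clean C S G) (h1 : G' ≤ G) (h2 : G' ≤ S') :
    Clean C S' G' :=
  ⟨h2, fun s hs => h.hits s (Multiset.mem_of_le h1 hs), fun s hs s' hs' =>
    h.free s (Multiset.mem_of_le h1 hs) s' (Multiset.mem_of_le h1 hs')⟩

open Classical in
theorem Clean.card_le {S G : Multiset Seg} (h : Clean C S G) : G.card ≤ S.countP (Hits C) := by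
  rw [← Multiset.countP_eq_card.2 h.hits]
  exact Multiset.countP_le_of_le _ h.le

theorem freeCount_le (s : Seg) : freeCount F C s ≤ F.card := by
  classical
  rw [freeCount]; split_ifs
  · simp
  · exact Finset.card_filter_le _ _

/-- An arbitrary flip spoils little. -/
theorem Clean.flip {S S' G : Multiset Seg} (h : Clean C S G) (hf : IsFlip S S') :
    ∃ G', Clean C S' G' ∧ pending C S' G' ≤ pending C S G + 4 ∧
      total (freeCount F' C) S' ≤ total (freeCount F' C) S + 2 * F'.card := by
  classical
  obtain ⟨a, b, c, d, R, rfl, rfl, -, -⟩ := hf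
  have hle : (G.erase s(a, b)).erase s(c, d) ≤ R := by
    have := Multiset.erase_le_erase s(c, d) (Multiset.erase_le_erase s(a, b) h.le)
    simpa using this
  have h1 : (G.erase s(a, b)).erase s(c, d) ≤ G :=
    (Multiset.erase_le _ _).trans (Multiset.erase_le _ _)
  have hle' : (G.erase s(a, b)).erase s(c, d) ≤ s(a, c) ::ₘ s(b, d) ::ₘ R :=
    hle.trans ((Multiset.le_cons_self _ _).trans (Multiset.le_cons_self _ _))
  refine ⟨_, h.mono h1 hle', ?_, ?_⟩
  · have c1 : (G.erase s(a, b)).card + 1 ≥ G.card := by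
      by_cases hm : s(a, b) ∈ G
      · rw [Multiset.card_erase_add_one hm]
      · rw [Multiset.erase_of_notMem hm]; omega
    have c2 : ((G.erase s(a, b)).erase s(c, d)).card + 1 ≥ (G.erase s(a, b)).card := by
      by_cases hm : s(c, d) ∈ G.erase s(a, b)
      · rw [Multiset.card_erase_add_one hm]
      · rw [Multiset.erase_of_notMem hm]; omega
    have c3 := h.card_le
    simp only [pending, Multiset.countP_cons] at c3 ⊢
    split_ifs at c3 ⊢ <;> omega
  · have u1 := freeCount_le (F := F') (C := C) s(a, c)
    have u2 := freeCount_le (F := F') (C := C) s(b, d)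
    simp only [total_cons]
    omega

theorem dist_lt_of_mem_openSegment {p x w : Plane} (hpx : p ≠ x) (hw : w ∈ openSegment ℝ p x) :
    dist p w < dist p x := by
  obtain ⟨α, β, hα, hβ, hs, rfl⟩ := hw
  have : p - (α • p + β • x) = β • (p - x) := by
    obtain rfl : α = 1 - β := by linarith
    apply plane_ext <;> simp <;> ring
  rw [dist_eq_norm, dist_eq_norm, this, norm_smul, Real.norm_of_nonneg hβ.le]
  have hpos : 0 < ‖p - x‖ := norm_pos_iff.2 (sub_ne_zero.2 hpx)
  nlinarith

open Classical in
/-- Among the segments of `G` that cross `pr`, one crosses it closest to `p`. -/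
theorem exists_closest_crossing {p r : Plane} {G : Multiset Seg} (hpr : p ≠ r)
    (hG : ∃ σ ∈ G, Crossing s(p, r) σ) :
    ∃ σ ∈ G, Crossing s(p, r) σ ∧ ∃ a b x : Plane, σ = s(b, a) ∧ x ∈ openSegment ℝ p r ∧
      x ∈ openSegment ℝ b a ∧
      ∀ ρ ∈ G, Crossing s(p, r) ρ → ∀ w ∈ ρ.carrier, w ∉ openSegment ℝ p x := by
  -- f picks the crossing point with pr; its value p for other segments is a dummy.
  have hf : ∀ σ : Seg, ∃ x : Plane, Crossing s(p, r) σ →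
      segment ℝ p r ∩ σ.carrier = {x} := by
    intro σ
    by_cases hc : Crossing s(p, r) σ
    · obtain ⟨x, hx, -⟩ := hc; exact ⟨x, fun _ => hx⟩
    · exact ⟨p, fun h => absurd h hc⟩
  choose f hf using hf
  obtain ⟨σ₀, hσ₀, hc₀⟩ := hG
  obtain ⟨σ, hσ, hmin⟩ := (G.toFinset.filter (Crossing s(p, r))).exists_min_image
    (fun σ => dist p (f σ)) ⟨σ₀, by simp [hσ₀, hc₀]⟩
  simp only [Finset.mem_filter, Multiset.mem_toFinset] at hσ hmin
  refine ⟨σ, hσ.1, hσ.2, ?_⟩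
  have hcσ := hσ.2
  induction σ using Sym2.ind with
  | _ b a =>
  obtain ⟨x, hx, hx'⟩ := hcσ.exists_mem
  have hxf : x = f s(b, a) := by
    have : x ∈ segment ℝ p r ∩ Seg.carrier s(b, a) :=
      ⟨openSegment_subset_segment _ _ _ hx, openSegment_subset_segment _ _ _ hx'⟩
    rw [hf _ hcσ] at this
    exact this
  refine ⟨a, b, x, rfl, hx, hx', fun ρ hρ hcρ w hw hwx => ?_⟩
  have hpx : p ≠ x := by rintro rfl; exact hpr (left_mem_openSegment_iff.1 hx)
  have h1 := dist_lt_of_mem_openSegment hpx hwx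
  have hwpr : w ∈ segment ℝ p r := (convex_segment p r).segment_subset (left_mem_segment ℝ p r)
    (openSegment_subset_segment ℝ _ _ hx) (openSegment_subset_segment ℝ _ _ hwx)
  have hwf : w = f ρ := by
    have : w ∈ segment ℝ p r ∩ Seg.carrier ρ := ⟨hwpr, hw⟩
    rw [hf _ hcρ] at this
    exact this
  have h2 := hmin ρ ⟨hρ, hcρ⟩
  rw [← hwf, ← hxf] at h2
  linarith

theorem countP_le_countP_of_imp {α : Type*} {p q : α → Prop} [DecidablePred p] [DecidablePred q]
    {s : Multiset α} (h : ∀ a ∈ s, p a → q a) : s.countP p ≤ s.countP q := by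
  induction s using Multiset.induction with
  | empty => simp
  | cons a s ih =>
    have h1 := ih fun b hb => h b (Multiset.mem_cons_of_mem hb)
    have h2 := h a (Multiset.mem_cons_self _ _)
    simp only [Multiset.countP_cons]
    split_ifs <;> first | omega | (exfalso; tauto)

theorem freeCount_of_hits {s : Seg} (h : Hits C s) : freeCount F C s = 0 := by
  rw [freeCount, if_pos h]

/-- A segment missing the hull is settled with both endpoints in `T`, so inserting it would lower
the energy. Hence, without an energy drop, the inserted segments remain candidates for the
crossing-free part. -/
theorem OuterPosition.hits_of_energy_le (h : OuterPosition P C T) (hF : TangentFamily P C F)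
    {a b c d x : Plane} (ha : a ∈ P) (hc' : c ∈ P) (hab : a ≠ b) (hcd : c ≠ d)
    (hc : Crossing s(a, b) s(c, d)) (hx : x ∈ openSegment ℝ a b) (hx' : x ∈ openSegment ℝ c d)
    (hxK : x ∈ convexHull ℝ (C : Set Plane))
    (hE : energy F C T s(a, b) + energy F C T s(c, d) ≤
      energy F C T s(a, c) + energy F C T s(b, d)) : Hits C s(a, c) := by
  by_contra hn
  have := h.endCount_of_not_hits ha hc' hc.four_ne.1 hn
  have := energy_flip_lt (T := T) hF hab hcd hc hx hx' hxK (settled_of_not_hits hn) (by omega)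
  omega

theorem CrossingFree.cons {s : Seg} {G : Multiset Seg} (hG : CrossingFree G)
    (h : ∀ ρ ∈ G, ¬ Crossing s ρ) : CrossingFree (s ::ₘ G) := by
  intro s₁ h1 s₂ h2
  rw [Multiset.mem_cons] at h1 h2
  rcases h1 with rfl | h1 <;> rcases h2 with rfl | h2
  · exact fun hc => hc.ne rfl
  · exact h s₂ h2
  · exact fun hc => h s₁ h1 hc.symm
  · exact hG s₁ h1 s₂ h2

open Classical in
/-- One pending segment `τ` can be made part of the clean segments with few flips, unless the
energy decreases. -/
theorem OuterPosition.insert_segment (h : OuterPosition P C T) (hF : TangentFamily P C F) (k : ℕ) :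
    ∀ (S : Multiset Seg) (τ : Seg) (G : Multiset Seg), Valid P n S → Clean C S G → τ ::ₘ G ≤ S →
      Hits C τ → G.countP (Crossing τ) ≤ k →
      ∃ j ≤ k + 1, ∃ S' G', FlipPath j S S' ∧ Clean C S' G' ∧
        ((total (energy F C T) S' < total (energy F C T) S ∧
          pending C S' G' ≤ pending C S G + 8 ∧
          total (freeCount F' C) S' ≤ total (freeCount F' C) S + 4 * F'.card) ∨
        (total (energy F C T) S' ≤ total (energy F C T) S ∧
          pending C S' G' + 1 ≤ pending C S G ∧
          total (freeCount F' C) S' ≤ total (freeCount F' C) S)) := by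
  induction k with
  | zero =>
    intro S τ G _ hG hle hτ hk
    have hnone : ∀ ρ ∈ G, ¬ Crossing τ ρ := fun ρ hρ hc => by
      have := Multiset.countP_pos.2 ⟨ρ, hρ, hc⟩
      omega
    have hG' : Clean C S (τ ::ₘ G) := ⟨hle, fun s hs => by
      rcases Multiset.mem_cons.1 hs with rfl | hs
      exacts [hτ, hG.hits s hs], hG.free.cons hnone⟩
    refine ⟨0, by omega, S, τ ::ₘ G, .refl S, hG', Or.inr ⟨le_rfl, ?_, le_rfl⟩⟩
    have := hG'.card_le
    simp only [pending, Multiset.card_cons] at this ⊢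
    omega
  | succ k ih =>
    intro S τ G hS hG hle hτ hk
    by_cases hout : ∃ S', IsFlip S S' ∧ total (energy F C T) S' < total (energy F C T) S
    · obtain ⟨S', hf, hE⟩ := hout
      obtain ⟨G', hG', hp, hY⟩ := hG.flip (F' := F') hf
      exact ⟨1, by omega, S', G', .single hf, hG', Or.inl ⟨hE, by omega, by omega⟩⟩
    -- As no single flip lowers the energy, every crossing with a segment that meets the hull lies
    -- in the hull.
    have hin : ∀ a b c d x : Plane, s(a, b) ∈ S → s(c, d) ∈ S → Crossing s(a, b) s(c, d) →
        x ∈ openSegment ℝ a b → x ∈ openSegment ℝ c d → Hits C s(a, b) →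
        x ∈ convexHull ℝ (C : Set Plane) := by
      intro a b c d x h1 h2 hc hx hx' hhit
      by_contra hxK
      exact hout (h.event_outside hF hS h1 h2 hc hx hx' hxK hhit)
    by_cases hcross : ∃ σ ∈ G, Crossing τ σ
    swap
    · refine (ih S τ G hS hG hle hτ ?_).imp fun j hj => ⟨by omega, hj.2⟩
      have : G.countP (Crossing τ) = 0 := Multiset.countP_eq_zero.2 fun ρ hρ hc => hcross ⟨ρ, hρ, hc⟩
      omega
    induction τ using Sym2.ind with
    | _ p r =>
    have hτS : s(p, r) ∈ S := Multiset.mem_of_le hle (by simp)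
    have hpr := hS.ne hτS
    obtain ⟨σ, hσ, hc, a, b, x, rfl, hx, hx', hclosest⟩ := exists_closest_crossing hpr hcross
    have hσS : s(b, a) ∈ S := Multiset.mem_of_le hG.le hσ
    have hxK := hin p r b a x hτS hσS hc hx hx' hτ
    obtain ⟨G₀, rfl⟩ := Multiset.exists_cons_of_mem hσ
    obtain ⟨Q, hQ⟩ := Multiset.le_iff_exists_add.1 hle
    obtain ⟨R, hR⟩ : ∃ R, R = G₀ + Q := ⟨_, rfl⟩
    have hSR : S = s(p, r) ::ₘ s(b, a) ::ₘ R := by rw [hQ, hR]; simp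
    have hG₀R : G₀ ≤ R := by rw [hR]; exact Multiset.le_add_right _ _
    subst hSR
    -- After this flip pb is to take the place of ba in `G`, and ra that of the pending segment pr.
    have hf := hS.isFlip h.general hc
    set S₁ := s(p, b) ::ₘ s(r, a) ::ₘ R with hS₁
    have hv₁ := hS.flip hf
    have hba := hS.ne hσS
    have hnot : ∀ ρ ∈ G₀, ¬ Crossing s(b, a) ρ := fun ρ hρ =>
      hG.free _ (by simp) ρ (by simp [hρ])
    have hE₁ : total (energy F C T) S₁ ≤
        total (energy F C T) (s(p, r) ::ₘ s(b, a) ::ₘ R) := by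
      have := energy_flip_le (T := T) hF hpr hba hc hx hx' hxK
      simp only [hS₁, total_cons]; omega
    have hE₁' : ¬ total (energy F C T) S₁ <
        total (energy F C T) (s(p, r) ::ₘ s(b, a) ::ₘ R) := fun hlt => hout ⟨_, hf, hlt⟩
    have hEeq : energy F C T s(p, r) + energy F C T s(b, a) ≤
        energy F C T s(p, b) + energy F C T s(r, a) := by
      simp only [hS₁, total_cons] at hE₁'; omega
    have hhit₁ : Hits C s(p, b) := h.hits_of_energy_le hF (hS.mem_left hτS) (hS.mem_left hσS) hpr hba
      hc hx hx' hxK hEeq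
    have hc' : Crossing s(r, p) s(a, b) := by rwa [Sym2.eq_swap, Sym2.eq_swap (a := a)]
    have hxs : x ∈ openSegment ℝ r p := by rwa [openSegment_symm]
    have hxs' : x ∈ openSegment ℝ a b := by rwa [openSegment_symm]
    have hhit₂ : Hits C s(r, a) := h.hits_of_energy_le hF (hS.mem_right hτS) (hS.mem_right hσS)
      hpr.symm hba.symm hc' hxs hxs' hxK (by
        rw [Sym2.eq_swap, Sym2.eq_swap (a := a)]; omega)
    have hnew : s(r, a) ::ₘ s(p, b) ::ₘ G₀ ≤ S₁ := by
      rw [Multiset.cons_swap, hS₁]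
      exact Multiset.cons_le_cons _ (Multiset.cons_le_cons _ hG₀R)
    -- A failure after the first flip costs one more flip; two applications of `Clean.flip` give the
    -- 8 and the 4.
    have second : (∃ S₂, IsFlip S₁ S₂ ∧ total (energy F C T) S₂ < total (energy F C T) S₁) →
        ∃ j ≤ k + 1 + 1, ∃ S' G', FlipPath j (s(p, r) ::ₘ s(b, a) ::ₘ R) S' ∧ Clean C S' G' ∧
        ((total (energy F C T) S' < total (energy F C T) (s(p, r) ::ₘ s(b, a) ::ₘ R) ∧
          pending C S' G' ≤ pending C (s(p, r) ::ₘ s(b, a) ::ₘ R) (s(b, a) ::ₘ G₀) + 8 ∧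
          total (freeCount F' C) S' ≤
            total (freeCount F' C) (s(p, r) ::ₘ s(b, a) ::ₘ R) + 4 * F'.card) ∨
        (total (energy F C T) S' ≤ total (energy F C T) (s(p, r) ::ₘ s(b, a) ::ₘ R) ∧
          pending C S' G' + 1 ≤ pending C (s(p, r) ::ₘ s(b, a) ::ₘ R) (s(b, a) ::ₘ G₀) ∧
          total (freeCount F' C) S' ≤
            total (freeCount F' C) (s(p, r) ::ₘ s(b, a) ::ₘ R))) := by
      rintro ⟨S₂, hf₂, hE₂⟩
      obtain ⟨G₁, hG₁, hp₁, hY₁⟩ := hG.flip (F' := F') hf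
      obtain ⟨G₂, hG₂, hp₂, hY₂⟩ := hG₁.flip (F' := F') hf₂
      exact ⟨2, by omega, S₂, G₂, .step hf (.single hf₂), hG₂,
        Or.inl ⟨by omega, by omega, by omega⟩⟩
    -- No ρ in `G₀` meets px, because σ crosses pr closest to p.
    by_cases hcr₁ : ∃ ρ ∈ G₀, Crossing s(p, b) ρ
    · obtain ⟨ρ, hρ, hcρ⟩ := hcr₁
      refine second (h.event_inserted hF hS hc hx hx' hxK (Multiset.mem_of_le hG₀R hρ) hcρ hhit₁
        (hnot ρ hρ) fun w hw hwx => ?_)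
      have hρS : ρ ∈ s(p, r) ::ₘ s(b, a) ::ₘ R := by
        simp [Multiset.mem_of_le hG₀R hρ]
      refine hclosest ρ (by simp [hρ]) ?_ w hw hwx
      have hwpr : w ∈ openSegment ℝ p r := by
        obtain ⟨α, β, hα, hβ, hs, rfl⟩ := hx
        obtain ⟨γ, δ, hγ, hδ, hs', rfl⟩ := hwx
        refine ⟨γ + δ * α, δ * β, by positivity, by positivity, ?_, ?_⟩
        · linear_combination δ * hs + hs'
        · apply plane_ext <;> simp <;> ring
      induction ρ using Sym2.ind with
      | _ e f =>
      refine crossing_of_meets h.general hS hτS hρS ?_ hw hwpr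
      exact fun hh => hcρ.disjoint (p := p) (by simp) (by simp [← hh])
    -- Nothing is known about the crossings of pr between x and r, so at the end r only segments
    -- that do not cross pr are treated as failures.
    by_cases hcr₂ : ∃ ρ ∈ G₀, Crossing s(r, a) ρ ∧ ¬ Crossing s(p, r) ρ
    · obtain ⟨ρ, hρ, hcρ, hnρ⟩ := hcr₂
      have hS' : Valid P n (s(r, p) ::ₘ s(a, b) ::ₘ R) := by
        rwa [Sym2.eq_swap, Sym2.eq_swap (a := a)]
      have := h.event_inserted hF hS' hc' hxs hxs' hxK (Multiset.mem_of_le hG₀R hρ) hcρ hhit₂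
        (by rw [Sym2.eq_swap]; exact hnot ρ hρ) fun w hw hwx => by
          have hρS : ρ ∈ s(p, r) ::ₘ s(b, a) ::ₘ R := by
            simp [Multiset.mem_of_le hG₀R hρ]
          have hwpr : w ∈ openSegment ℝ p r := by
            rw [openSegment_symm]
            obtain ⟨α, β, hα, hβ, hs, rfl⟩ := hxs
            obtain ⟨γ, δ, hγ, hδ, hs', rfl⟩ := hwx
            refine ⟨γ + δ * α, δ * β, by positivity, by positivity, ?_, ?_⟩
            · linear_combination δ * hs + hs'
            · apply plane_ext <;> simp <;> ring
          induction ρ using Sym2.ind with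
          | _ e f =>
          refine hnρ (crossing_of_meets h.general hS hτS hρS ?_ hw hwpr)
          exact fun hh => hcρ.disjoint (p := r) (by simp) (by simp [← hh])
      rw [Multiset.cons_swap] at this
      exact second this
    push Not at hcr₁ hcr₂
    have hfree : CrossingFree G₀ := fun s hs s' hs' => hG.free s (by simp [hs]) s' (by simp [hs'])
    have hG₁ : Clean C S₁ (s(p, b) ::ₘ G₀) := by
      refine ⟨(Multiset.le_cons_self _ _).trans hnew, fun s hs => ?_, hfree.cons hcr₁⟩
      rcases Multiset.mem_cons.1 hs with rfl | hs
      exacts [hhit₁, hG.hits s (by simp [hs])]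
    have hnc : ¬ Crossing s(r, a) s(p, b) := fun hcc => not_crossing_flip hx hx'
      (hc.orient_ne_zero h.general (hS.mem_left hτS) (hS.mem_right hτS) (hS.mem_left hσS) hpr)
      hcc.symm
    -- Whatever crosses ra in `G₀` also crosses pr, but σ crossed pr and is gone, and pb does not
    -- cross ra.
    have hcount : (s(p, b) ::ₘ G₀).countP (Crossing s(r, a)) ≤ k := by
      rw [Multiset.countP_cons_of_neg _ hnc]
      rw [Multiset.countP_cons_of_pos _ hc] at hk
      have := countP_le_countP_of_imp (s := G₀) (p := Crossing s(r, a)) (q := Crossing s(p, r))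
        hcr₂
      omega
    obtain ⟨j, hj, S', G', hpath, hclean, hres⟩ := ih S₁ s(r, a) (s(p, b) ::ₘ G₀) hv₁ hG₁ hnew
      hhit₂ hcount
    have hpend : pending C S₁ (s(p, b) ::ₘ G₀) =
        pending C (s(p, r) ::ₘ s(b, a) ::ₘ R) (s(b, a) ::ₘ G₀) := by
      have hσhit := hG.hits s(b, a) (by simp)
      simp only [pending, hS₁, Multiset.countP_cons_of_pos _ hhit₁,
        Multiset.countP_cons_of_pos _ hhit₂, Multiset.countP_cons_of_pos _ hτ,
        Multiset.countP_cons_of_pos _ hσhit, Multiset.card_cons]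
    have hfc : total (freeCount F' C) S₁ =
        total (freeCount F' C) (s(p, r) ::ₘ s(b, a) ::ₘ R) := by
      have hσhit := hG.hits s(b, a) (by simp)
      simp only [hS₁, total_cons, freeCount_of_hits hhit₁, freeCount_of_hits hhit₂,
        freeCount_of_hits hτ, freeCount_of_hits hσhit]
    rw [hpend, hfc] at hres
    refine ⟨j + 1, by omega, S', G', .step hf hpath, hclean, ?_⟩
    rcases hres with ⟨r1, r2, r3⟩ | ⟨r1, r2, r3⟩
    · exact Or.inl ⟨by omega, r2, r3⟩
    · exact Or.inr ⟨by omega, r2, r3⟩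

end Insertion

/-! ### Untangling by potentials -/

section Main

variable {P C T : Finset Plane} {F : Finset (Set Plane)} {n : ℕ}

open Classical in
/-- The half-planes bounded by the lines through two points of `T`. -/
noncomputable def lineFamily (T : Finset Plane) : Finset (Set Plane) :=
  (T ×ˢ T).image fun uv => leftSide uv.1 uv.2 {uv.1}

theorem lineFamily_card (T : Finset Plane) : (lineFamily T).card ≤ T.card ^ 2 := by
  classical
  refine Finset.card_image_le.trans ?_
  rw [Finset.card_product, sq]

theorem lineFamily_split (T : Finset Plane) : ∀ H ∈ lineFamily T, IsSplit H := by
  classical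
  intro H hH
  obtain ⟨uv, -, rfl⟩ := Finset.mem_image.1 hH
  exact isSplit_leftSide Set.subsingleton_singleton (by simp)

theorem freeCount_of_not_hits {F' : Finset (Set Plane)} {s : Seg} (h : ¬ Hits C s) :
    freeCount F' C s = sepCount F' s := by rw [freeCount, if_neg h]

/-- Two crossing segments that miss the hull of `C` can be flipped away from the hull. -/
theorem OuterPosition.flip_free (h : OuterPosition P C T) (hF : TangentFamily P C F)
    {s₁ s₂ : Seg} {R : Multiset Seg} (hS : Valid P n (s₁ ::ₘ s₂ ::ₘ R)) (hc : Crossing s₁ s₂)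
    (h1 : ¬ Hits C s₁) (h2 : ¬ Hits C s₂) :
    ∃ s₃ s₄, IsFlip (s₁ ::ₘ s₂ ::ₘ R) (s₃ ::ₘ s₄ ::ₘ R) ∧ ¬ Hits C s₃ ∧ ¬ Hits C s₄ ∧
      energy F C T s₃ + energy F C T s₄ ≤ energy F C T s₁ + energy F C T s₂ ∧
      freeCount (lineFamily T) C s₃ + freeCount (lineFamily T) C s₄ <
        freeCount (lineFamily T) C s₁ + freeCount (lineFamily T) C s₂ := by
  classical
  have key : ∀ a b c d x : Plane, s(a, b) = s₁ → s(c, d) = s₂ → x ∈ openSegment ℝ a b →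
      x ∈ openSegment ℝ c d → (∀ z ∈ segment ℝ a c, z ∉ convexHull ℝ (C : Set Plane)) →
      (∀ z ∈ segment ℝ b d, z ∉ convexHull ℝ (C : Set Plane)) →
      ∃ s₃ s₄, IsFlip (s₁ ::ₘ s₂ ::ₘ R) (s₃ ::ₘ s₄ ::ₘ R) ∧ ¬ Hits C s₃ ∧ ¬ Hits C s₄ ∧
      energy F C T s₃ + energy F C T s₄ ≤ energy F C T s₁ + energy F C T s₂ ∧
      freeCount (lineFamily T) C s₃ + freeCount (lineFamily T) C s₄ <
        freeCount (lineFamily T) C s₁ + freeCount (lineFamily T) C s₂ := by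
    rintro a b c d x rfl rfl hx hx' hac hbd
    have hab := hS.ne (a := a) (b := b) (by simp)
    have hcd := hS.ne (a := c) (b := d) (by simp)
    have n1 : ¬ Hits C s(a, c) := fun ⟨z, hz, hK⟩ => hac z hz hK
    have n2 : ¬ Hits C s(b, d) := fun ⟨z, hz, hK⟩ => hbd z hz hK
    refine ⟨_, _, hS.isFlip h.general hc, n1, n2, ?_, ?_⟩
    · have := sepCount_flip hF.split hx hx' hab hcd
      simp only [energy, unsettledCount_of_settled (settled_of_not_hits n1),
        unsettledCount_of_settled (settled_of_not_hits n2)]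
      omega
    · have ha : a ∈ P := hS.mem_left (b := b) (by simp)
      have hb : b ∈ P := hS.mem_right (a := a) (by simp)
      have hc' : c ∈ P := hS.mem_left (b := d) (by simp)
      have hd : d ∈ P := hS.mem_right (a := c) (by simp)
      -- Segments that miss the hull have all endpoints in `T`, so the half-plane found below
      -- belongs to `lineFamily T`.
      have haT := ((h.mem_iff a).1 ha).resolve_left fun hC => h1 (hits_of_mem_left hC)
      have hbT := ((h.mem_iff b).1 hb).resolve_left fun hC => h1 (hits_of_mem_right hC)
      have hcT := ((h.mem_iff c).1 hc').resolve_left fun hC => h2 (hits_of_mem_left hC)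
      have hdT := ((h.mem_iff d).1 hd).resolve_left fun hC => h2 (hits_of_mem_right hC)
      obtain ⟨u, hu, v, hv, m1, m2, m3, m4⟩ := exists_leftSide hx hx'
        (hc.orient_ne_zero h.general ha hb hc' hab)
      have huT : u ∈ T := by rcases hu with rfl | rfl <;> assumption
      have hvT : v ∈ T := by rcases hv with rfl | rfl <;> assumption
      rw [freeCount_of_not_hits n1, freeCount_of_not_hits n2, freeCount_of_not_hits h1,
        freeCount_of_not_hits h2]
      exact sepCount_flip_lt (lineFamily_split T) hx hx' hab hcd
        (Finset.mem_image.2 ⟨(u, v), Finset.mem_product.2 ⟨huT, hvT⟩, rfl⟩) m1 m2 m3 m4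
  induction s₁ using Sym2.ind with
  | _ a b =>
  induction s₂ using Sym2.ind with
  | _ c d =>
  obtain ⟨x, hx, hx'⟩ := hc.exists_mem
  rcases exists_insertion_misses (convex_convexHull ℝ (C : Set Plane)) hx hx'
    (fun z hz hK => h1 ⟨z, hz, hK⟩) (fun z hz hK => h2 ⟨z, hz, hK⟩) with ⟨i1, i2⟩ | ⟨i1, i2⟩
  · exact key a b c d x rfl rfl hx hx' i1 i2
  · exact key a b d c x rfl Sym2.eq_swap hx (by rwa [openSegment_symm]) i1 i2

/-- Every matching can be untangled; the number of flips is bounded in terms of the potentials. -/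
theorem OuterPosition.untangle (h : OuterPosition P C T) (hF : TangentFamily P C F) (m : ℕ) :
    ∀ (S G : Multiset Seg), Valid P n S → Clean C S G →
      (9 * (n + 2) + 4 * (lineFamily T).card) * total (energy F C T) S +
        (n + 2) * pending C S G + total (freeCount (lineFamily T) C) S ≤ m →
      ∃ j ≤ m, ∃ S', FlipPath j S S' ∧ CrossingFree S' := by
  classical
  induction m using Nat.strong_induction_on with
  | _ m ih =>
  intro S G hS hG hm
  -- One unit of energy pays for the worst insertion: 8 more pending segments at n + 2 each, four
  -- times the size of `lineFamily T`, and n + 2 for its at most n + 1 flips.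
  set A := 9 * (n + 2) + 4 * (lineFamily T).card with hA
  have energy_drop : ∀ {e e' : ℕ}, e' < e → A * e' + A ≤ A * e := fun {e e'} he => by
    have := Nat.mul_le_mul_left A (Nat.succ_le_of_lt he)
    rwa [Nat.mul_succ] at this
  by_cases hpend : 0 < pending C S G
  · obtain ⟨τ, hτ, hτG⟩ : ∃ τ, Hits C τ ∧ τ ::ₘ G ≤ S := by
      have hle : G ≤ S.filter (Hits C) := Multiset.le_filter.2 ⟨hG.le, hG.hits⟩
      have hlt : G < S.filter (Hits C) := lt_of_le_of_ne hle fun he => by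
        rw [pending, Multiset.countP_eq_card_filter, ← he] at hpend
        omega
      obtain ⟨τ, hτ⟩ := Multiset.lt_iff_cons_le.1 hlt
      exact ⟨τ, Multiset.of_mem_filter (Multiset.mem_of_le hτ (by simp)),
        hτ.trans (Multiset.filter_le _ _)⟩
    have hk : G.countP (Crossing τ) ≤ n :=
      (Multiset.countP_le_card _ _).trans ((Multiset.card_le_card hG.le).trans hS.1.le)
    obtain ⟨j, hj, S', G', hpath, hG', hres⟩ :=
      h.insert_segment (F' := lineFamily T) hF n S τ G hS hG hτG hτ hk
    have hS' := hS.flipPath hpath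
    have hbound : A * total (energy F C T) S' + (n + 2) * pending C S' G' +
        total (freeCount (lineFamily T) C) S' + (n + 2) ≤ m := by
      rcases hres with ⟨r1, r2, r3⟩ | ⟨r1, r2, r3⟩
      · have e1 := energy_drop r1
        have e2 := Nat.mul_le_mul_left (n + 2) r2
        rw [Nat.mul_add] at e2
        omega
      · have e1 := Nat.mul_le_mul_left A r1
        have e2 := Nat.mul_le_mul_left (n + 2) r2
        rw [Nat.mul_add] at e2
        omega
    obtain ⟨j', hj', S'', hpath', hfree⟩ := ih (m - (n + 2)) (by omega) S' G' hS' hG' (by omega)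
    exact ⟨j + j', by omega, S'', hpath.trans hpath', hfree⟩
  have hall : ∀ s ∈ S, Hits C s → s ∈ G := by
    intro s hs hhit
    have hle : G ≤ S.filter (Hits C) := Multiset.le_filter.2 ⟨hG.le, hG.hits⟩
    have : G = S.filter (Hits C) := by
      refine Multiset.eq_of_le_of_card_le hle ?_
      rw [← Multiset.countP_eq_card_filter]
      rw [pending] at hpend
      omega
    rw [this]
    exact Multiset.mem_filter.2 ⟨hs, hhit⟩
  by_cases hfree : CrossingFree S
  · exact ⟨0, by omega, S, .refl S, hfree⟩
  simp only [CrossingFree, not_forall, not_not] at hfree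
  obtain ⟨s₁, h1, s₂, h2, hc⟩ := hfree
  by_cases hevent : ∃ S', IsFlip S S' ∧ total (energy F C T) S' < total (energy F C T) S
  · obtain ⟨S', hf, hE⟩ := hevent
    obtain ⟨G', hG', hp, hY⟩ := hG.flip (F' := lineFamily T) hf
    have e1 := energy_drop hE
    have e2 := Nat.mul_le_mul_left (n + 2) hp
    rw [Nat.mul_add] at e2
    obtain ⟨j, hj, S'', hpath, hfree⟩ := ih (m - 1) (by omega) S' G' (hS.flip hf) hG' (by omega)
    exact ⟨j + 1, by omega, S'', .step hf hpath, hfree⟩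
  -- A crossing in the hull would be one between segments of `G`; a crossing outside it with a
  -- segment that meets the hull would permit an energy drop.
  have hmiss : ¬ Hits C s₁ ∧ ¬ Hits C s₂ := by
    by_contra hn
    induction s₁ using Sym2.ind with
    | _ a b =>
    induction s₂ using Sym2.ind with
    | _ c d =>
    obtain ⟨x, hx, hx'⟩ := hc.exists_mem
    by_cases hxK : x ∈ convexHull ℝ (C : Set Plane)
    · exact hG.free _ (hall _ h1 (hits_of_mem hx hxK)) _ (hall _ h2 (hits_of_mem hx' hxK)) hc
    · by_cases hh : Hits C s(a, b)
      · exact hevent (h.event_outside hF hS h1 h2 hc hx hx' hxK hh)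
      · have hh' : Hits C s(c, d) := by tauto
        exact hevent (h.event_outside hF hS h2 h1 hc.symm hx' hx hxK hh')
  obtain ⟨R, rfl⟩ := exists_cons_cons h1 h2 hc.ne
  obtain ⟨s₃, s₄, hf, n3, n4, hE, hY⟩ := h.flip_free hF hS hc hmiss.1 hmiss.2
  have hGR : G ≤ R := by
    have := hG.le
    rwa [Multiset.le_cons_of_notMem (fun hm => hmiss.1 (hG.hits _ hm)),
      Multiset.le_cons_of_notMem (fun hm => hmiss.2 (hG.hits _ hm))] at this
  have hG' : Clean C (s₃ ::ₘ s₄ ::ₘ R) G := hG.mono le_rfl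
    (hGR.trans ((Multiset.le_cons_self _ _).trans (Multiset.le_cons_self _ _)))
  have hp : pending C (s₃ ::ₘ s₄ ::ₘ R) G = pending C (s₁ ::ₘ s₂ ::ₘ R) G := by
    simp only [pending, Multiset.countP_cons_of_neg _ n3, Multiset.countP_cons_of_neg _ n4,
      Multiset.countP_cons_of_neg _ hmiss.1, Multiset.countP_cons_of_neg _ hmiss.2]
  have e1 : A * total (energy F C T) (s₃ ::ₘ s₄ ::ₘ R) ≤
      A * total (energy F C T) (s₁ ::ₘ s₂ ::ₘ R) :=
    Nat.mul_le_mul_left A (by simp only [total_cons]; omega)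
  have e2 : total (freeCount (lineFamily T) C) (s₃ ::ₘ s₄ ::ₘ R) <
      total (freeCount (lineFamily T) C) (s₁ ::ₘ s₂ ::ₘ R) := by
    simp only [total_cons]; omega
  obtain ⟨j, hj, S'', hpath, hfree⟩ := ih (m - 1) (by omega) _ G (hS.flip hf) hG' (by
    rw [hp]; omega)
  exact ⟨j + 1, by omega, S'', .step hf hpath, hfree⟩

end Main

/-! ### Matchings in convex position -/

section Convex

variable {P C T : Finset Plane} {n : ℕ}

theorem OuterPosition.not_comb (h : OuterPosition P C T) {e x y z : Plane} (he : e ∈ C)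
    (hx : x ∈ C) (hy : y ∈ C) (hz : z ∈ C) (hxe : x ≠ e) (hye : y ≠ e) (hze : z ≠ e) {α β γ : ℝ}
    (hα : 0 < α) (hβ : 0 < β) (hγ : 0 < γ)
    (hc : ∀ i, (α + β + γ) * e i = α * x i + β * y i + γ * z i) : False := by
  obtain ⟨l, hl⟩ := h.exists_functional ((h.mem_iff e).2 (Or.inl he))
  have h1 := hl x (subset_convexHull ℝ _ hx) hxe
  have h2 := hl y (subset_convexHull ℝ _ hy) hye
  have h3 := hl z (subset_convexHull ℝ _ hz) hze
  have h4 : (α + β + γ) • e = α • x + β • y + γ • z := by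
    apply plane_ext
    · simpa using hc 0
    · simpa using hc 1
  have h5 := congrArg l h4
  simp only [map_add, map_smul, smul_eq_mul] at h5
  nlinarith

/-- Otherwise a would lie in the triangle bcz. -/
theorem OuterPosition.not_in_cone (h : OuterPosition P C T) {a b c z : Plane} (ha : a ∈ C)
    (hb : b ∈ C) (hc : c ∈ C) (hz : z ∈ C) (h1 : 0 < orient a b c) (h2 : orient a b z < 0) :
    ¬ 0 < orient a c z := by
  intro h3
  refine h.not_comb ha hb hc hz (by rintro rfl; simp at h1) (by rintro rfl; simp at h1)
    (by rintro rfl; simp at h2) h3 (neg_pos.2 h2) h1 fun i => ?_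
  fin_cases i <;> simp only [orient] <;> simp <;> ring

/-- In convex position, a segment whose line separates two points separates them. -/
theorem OuterPosition.orient_mul_neg (h : OuterPosition P C T) {a b c d : Plane} (ha : a ∈ C)
    (hb : b ∈ C) (hc : c ∈ C) (hd : d ∈ C) (h1 : 0 < orient a b c) (h2 : orient a b d < 0) :
    orient c d a * orient c d b < 0 := by
  have hP : ∀ {x}, x ∈ C → x ∈ P := fun hx => (h.mem_iff _).2 (Or.inl hx)
  have hab : a ≠ b := by rintro rfl; simp at h1
  have hac : c ≠ a := by rintro rfl; simp at h1
  have hbc : c ≠ b := by rintro rfl; simp at h1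
  have had : d ≠ a := by rintro rfl; simp at h2
  have hbd : d ≠ b := by rintro rfl; simp at h2
  have hcd : c ≠ d := by rintro rfl; linarith
  have n1 := h.general.orient_ne_zero (hP hc) (hP hd) (hP ha) hcd hac had
  have n2 := h.general.orient_ne_zero (hP hc) (hP hd) (hP hb) hcd hbc hbd
  by_contra hn
  push Not at hn
  -- With a and b on the same side of cd, one of them lies inside the triangle formed by the other
  -- with c and d.
  rcases lt_or_gt_of_ne n1 with s1 | s1
  · have s2 : orient c d b < 0 := by
      refine lt_of_le_of_ne ?_ n2
      by_contra hh; push Not at hh; nlinarith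
    refine h.not_comb hb ha hc hd hab hbc hbd (neg_pos.2 s2) (neg_pos.2 h2) h1 fun i => ?_
    fin_cases i <;> simp only [orient] <;> simp <;> ring
  · have s2 : 0 < orient c d b := by
      refine lt_of_le_of_ne ?_ n2.symm
      by_contra hh; push Not at hh; nlinarith
    refine h.not_comb ha hb hc hd hab.symm hac had s1 (neg_pos.2 h2) h1 fun i => ?_
    fin_cases i <;> simp only [orient] <;> simp <;> ring

theorem exists_mem_of_orient {a b c d : Plane} (h1 : 0 < orient a b c) (h2 : orient a b d < 0)
    (h3 : orient c d a * orient c d b < 0) :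
    ∃ x, x ∈ openSegment ℝ a b ∧ x ∈ openSegment ℝ c d := by
  have hd1 : 0 < orient a b c - orient a b d := by linarith
  have hsum : orient c d a - orient c d b = -(orient a b c - orient a b d) := by
    simp only [orient]; ring
  have ha : orient c d a < 0 := by
    by_contra hn; push Not at hn
    have : orient c d b < 0 := by
      by_contra hn'; push Not at hn'; nlinarith
    linarith
  have hb : 0 < orient c d b := by
    by_contra hn; push Not at hn; nlinarith
  refine ⟨(orient c d b / (orient a b c - orient a b d)) • a +
    (-orient c d a / (orient a b c - orient a b d)) • b,
    ⟨_, _, by positivity, div_pos (by linarith) hd1, ?_, rfl⟩,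
    -orient a b d / (orient a b c - orient a b d), orient a b c / (orient a b c - orient a b d),
    div_pos (by linarith) hd1, by positivity, ?_, ?_⟩
  · rw [← add_div, div_eq_one_iff_eq hd1.ne']; linarith
  · rw [← add_div, div_eq_one_iff_eq hd1.ne']; linarith
  · apply plane_ext <;> simp <;> field_simp <;> simp only [orient] <;> ring

open Classical in
/-- At most one flip turns some segment of a matching in convex position into a segment that has
all other segments on the same side of its line. -/
theorem OuterPosition.exists_hull_edge (h : OuterPosition P C T) {M R : Multiset Seg}
    (hS : Valid P n (M + R)) (hM : ∀ s ∈ M, ∀ p ∈ s, p ∈ C) (hne : M ≠ 0) :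
    ∃ a c M₁, ∃ j ≤ 1, FlipPath j (M + R) (s(a, c) ::ₘ M₁ + R) ∧ M₁.card + 1 = M.card ∧
      (∀ s ∈ s(a, c) ::ₘ M₁, ∀ p ∈ s, ∃ s' ∈ M, p ∈ s') ∧
      ∀ s ∈ M₁, ∀ p ∈ s, orient a c p < 0 := by
  have hP : ∀ {x}, x ∈ C → x ∈ P := fun hx => (h.mem_iff _).2 (Or.inl hx)
  obtain ⟨V, hV⟩ : ∃ V : Finset Plane, V = C.filter fun p => ∃ s ∈ M, p ∈ s := ⟨_, rfl⟩
  have hVC : ∀ p ∈ V, p ∈ C := fun p hp => by rw [hV] at hp; exact (Finset.mem_filter.1 hp).1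
  have hVM : ∀ p ∈ V, ∃ s ∈ M, p ∈ s := fun p hp => by
    rw [hV] at hp; exact (Finset.mem_filter.1 hp).2
  have hMV : ∀ s ∈ M, ∀ p ∈ s, p ∈ V := fun s hs p hp => by
    rw [hV]; exact Finset.mem_filter.2 ⟨hM s hs p hp, s, hs, hp⟩
  have hgp : ∀ {x y z}, x ∈ V → y ∈ V → z ∈ V → x ≠ y → x ≠ z → y ≠ z → orient x y z ≠ 0 :=
    fun hx hy hz => h.general.orient_ne_zero (hP (hVC _ hx)) (hP (hVC _ hy)) (hP (hVC _ hz))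
  obtain ⟨s₀, hs₀⟩ := Multiset.exists_mem_of_ne_zero hne
  have hpairs : ((C ×ˢ C).filter fun ab => s(ab.1, ab.2) ∈ M).Nonempty := by
    induction s₀ using Sym2.ind with
    | _ a b =>
    exact ⟨(a, b), by simp [hs₀, hM _ hs₀ a (by simp), hM _ hs₀ b (by simp)]⟩
  -- Pairs are ordered, so each segment competes with both of its sides.
  obtain ⟨⟨a, b⟩, hab, hmin⟩ := Finset.exists_min_image _
    (fun ab : Plane × Plane => (V.filter fun z => 0 < orient ab.1 ab.2 z).card) hpairs
  simp only [Finset.mem_filter, Finset.mem_product] at hab hmin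
  obtain ⟨⟨haC, hbC⟩, habM⟩ := hab
  have haV := hMV _ habM a (by simp)
  have hbV := hMV _ habM b (by simp)
  have hab : a ≠ b := hS.ne (Multiset.mem_add.2 (Or.inl habM))
  by_cases hA : (V.filter fun z => 0 < orient a b z).Nonempty
  swap
  · obtain ⟨M₁, rfl⟩ := Multiset.exists_cons_of_mem habM
    refine ⟨a, b, M₁, 0, by omega, .refl _, by simp, fun s hs p hp => ⟨s, hs, hp⟩, ?_⟩
    intro s hs p hp
    have hpV := hMV s (by simp [hs]) p hp
    obtain ⟨M₂, rfl⟩ := Multiset.exists_cons_of_mem hs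
    rw [Multiset.cons_add, Multiset.cons_add] at hS
    have hap : a ≠ p := by rintro rfl; exact hS.disjoint (by simp) hp
    have hbp : b ≠ p := by rintro rfl; exact hS.disjoint (by simp) hp
    refine lt_of_le_of_ne ?_ (hgp haV hbV hpV hab hap hbp)
    by_contra hn
    push Not at hn
    exact hA ⟨p, by simp [hpV, hn]⟩
  obtain ⟨c, hcA, hcmax⟩ := exists_orient_nonpos (q := a) (v₀ := -(b 1 - a 1)) (v₁ := b 0 - a 0) hA
    (fun z hz => by
      have := (Finset.mem_filter.1 hz).2
      simp only [orient] at this; linarith)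
  obtain ⟨hcV, hc⟩ := Finset.mem_filter.1 hcA
  obtain ⟨s, hs, hcs⟩ := hVM c hcV
  obtain ⟨d, rfl⟩ := hcs
  change s(c, d) ∈ M at hs
  have hdV := hMV _ hs d (by simp)
  have hcd : c ≠ d := hS.ne (Multiset.mem_add.2 (Or.inl hs))
  have hac : a ≠ c := by rintro rfl; simp at hc
  have hbc : b ≠ c := by rintro rfl; simp at hc
  have hsne : s(a, b) ≠ s(c, d) := fun hh => by
    have : c ∈ s(a, b) := by rw [hh]; simp
    rcases Sym2.mem_iff.1 this with rfl | rfl <;> simp at hc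
  obtain ⟨M₂, rfl⟩ := exists_cons_cons habM hs hsne
  have hS' : Valid P n (s(a, b) ::ₘ s(c, d) ::ₘ (M₂ + R)) := by simpa using hS
  have had : a ≠ d := fun hh => hS'.disjoint (p := a) (by simp) (by simp [hh])
  have hbd : b ≠ d := fun hh => hS'.disjoint (p := b) (by simp) (by simp [hh])
  have hdneg : orient a b d < 0 := by
    refine lt_of_le_of_ne ?_ (hgp haV hbV hdV hab had hbd)
    by_contra hdpos
    push Not at hdpos
    -- If cd were left of ab, direct it as ef with a on its right. Then b is on its right too, and
    -- all points left of ef are left of ab. As c is not among them, this contradicts the minimality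
    -- of ab.
    have key : ∀ e f : Plane, e ∈ V → f ∈ V → e ≠ f → a ≠ e → a ≠ f → b ≠ e → b ≠ f →
        0 < orient a b e → 0 < orient a b f → orient e f a < 0 →
        ∀ z ∈ V, 0 < orient e f z → 0 < orient a b z := by
      intro e f he hf hef hae haf hbe hbf hoe hof hefa z hz hefz
      have hefb : orient e f b < 0 := by
        refine lt_of_le_of_ne ?_ (hgp he hf hbV hef hbe.symm hbf.symm)
        by_contra hn
        push Not at hn
        have := h.orient_mul_neg (hVC _ he) (hVC _ hf) hbC haC hn hefa
        rw [orient_swap a b e, orient_swap a b f] at this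
        nlinarith [mul_pos hoe hof]
      by_contra hn
      have hza : a ≠ z := by rintro rfl; linarith
      have hzb : b ≠ z := by rintro rfl; linarith
      have hneg : orient a b z < 0 := lt_of_le_of_ne (not_lt.1 hn) (hgp haV hbV hz hab hza hzb)
      obtain ⟨x, hx, hx'⟩ := exists_mem_of_orient hoe hneg
        (h.orient_mul_neg haC hbC (hVC _ he) (hVC _ hz) hoe hneg)
      obtain ⟨α, β, hα, hβ, hs1, rfl⟩ := hx
      obtain ⟨γ, δ, hγ, hδ, hs2, hxe⟩ := hx'
      have hxx := congrArg (orient e f) hxe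
      rw [orient_comb _ _ _ _ hs1, orient_comb _ _ _ _ hs2, orient_left] at hxx
      nlinarith [mul_pos hδ hefz, mul_pos hα (neg_pos.2 hefa), mul_pos hβ (neg_pos.2 hefb)]
    have contra : ∀ e f : Plane, e ∈ V → f ∈ V → s(e, f) ∈ s(a, b) ::ₘ s(c, d) ::ₘ M₂ →
        c ∈ s(e, f) → (∀ z ∈ V, 0 < orient e f z → 0 < orient a b z) → False := by
      intro e f he hf hefM hcef hsub
      have h1 := hmin (e, f) ⟨⟨hVC _ he, hVC _ hf⟩, hefM⟩
      refine absurd h1 (not_le.2 (Finset.card_lt_card ?_))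
      refine Finset.ssubset_iff_subset_ne.2 ⟨fun z hz => ?_, fun heq => ?_⟩
      · obtain ⟨hz1, hz2⟩ := Finset.mem_filter.1 hz
        exact Finset.mem_filter.2 ⟨hz1, hsub z hz1 hz2⟩
      · rw [← heq] at hcA
        have := (Finset.mem_filter.1 hcA).2
        rcases Sym2.mem_iff.1 hcef with rfl | rfl <;> simp at this
    rcases lt_or_gt_of_ne (hgp hcV hdV haV hcd hac.symm had.symm) with h1 | h1
    · exact contra c d hcV hdV (by simp) (by simp)
        (key c d hcV hdV hcd hac had hbc hbd hc hdpos h1)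
    · exact contra d c hdV hcV (by simp [Sym2.eq_swap]) (by simp)
        (key d c hdV hcV hcd.symm had hac hbd hbc hdpos hc (by rw [orient_swap]; linarith))
  obtain ⟨x, hx, hx'⟩ := exists_mem_of_orient hc hdneg
    (h.orient_mul_neg haC hbC (hVC _ hcV) (hVC _ hdV) hc hdneg)
  have hcross := crossing_of_mem hx hx' hc.ne'
  refine ⟨a, c, s(b, d) ::ₘ M₂, 1, le_rfl, .single ?_, by simp, ?_, ?_⟩
  · have := hS'.isFlip h.general hcross
    simpa using this
  · intro s hs p hp
    simp only [Multiset.mem_cons] at hs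
    rcases hs with rfl | rfl | hs
    · exact hVM p (by rcases Sym2.mem_iff.1 hp with rfl | rfl <;> assumption)
    · exact hVM p (by rcases Sym2.mem_iff.1 hp with rfl | rfl <;> assumption)
    · exact ⟨s, by simp [hs], hp⟩
  · intro s hs p hp
    have hpV : p ∈ V ∧ a ≠ p ∧ c ≠ p := by
      rcases Multiset.mem_cons.1 hs with rfl | hs
      · rcases Sym2.mem_iff.1 hp with rfl | rfl
        · exact ⟨hbV, hab, hbc.symm⟩
        · exact ⟨hdV, had, hcd⟩
      · refine ⟨hMV s (by simp [hs]) p hp, ?_, ?_⟩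
        · rintro rfl
          obtain ⟨M₃, rfl⟩ := Multiset.exists_cons_of_mem hs
          rw [Multiset.cons_add, Multiset.cons_swap s(c, d), Multiset.cons_swap] at hS'
          exact hS'.disjoint (p := a) hp (by simp)
        · rintro rfl
          obtain ⟨M₃, rfl⟩ := Multiset.exists_cons_of_mem hs
          rw [Multiset.cons_add, Multiset.cons_swap, Multiset.cons_swap s(a, b)] at hS'
          exact hS'.disjoint (p := c) (by simp) hp
    obtain ⟨hpV, hap, hcp⟩ := hpV
    -- Points left of ab are right of ac by the choice of c, points right of ab by convex position.
    refine lt_of_le_of_ne ?_ (hgp haV hcV hpV hac hap hcp)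
    by_cases hbp : b = p
    · subst hbp; rw [orient_swap_right]; linarith
    rcases lt_or_gt_of_ne (hgp haV hbV hpV hab hap hbp) with h1 | h1
    · exact not_lt.1 (h.not_in_cone haC hbC (hVC _ hcV) (hVC _ hpV) hc h1)
    · exact hcmax p (by simp [hpV, h1])

/-- The segments with both endpoints in `C` can be untangled with one flip per segment. -/
theorem OuterPosition.untangle_convex (h : OuterPosition P C T) (m : ℕ) :
    ∀ M R : Multiset Seg, M.card = m → Valid P n (M + R) → (∀ s ∈ M, ∀ p ∈ s, p ∈ C) →
      ∃ j ≤ m, ∃ M', FlipPath j (M + R) (M' + R) ∧ CrossingFree M' ∧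
        ∀ s ∈ M', ∀ p ∈ s, ∃ s' ∈ M, p ∈ s' := by
  induction m with
  | zero =>
    intro M R hcard hS hM
    obtain rfl := Multiset.card_eq_zero.1 hcard
    exact ⟨0, le_rfl, 0, .refl _, by intro s hs; simp at hs, by simp⟩
  | succ m ih =>
    intro M R hcard hS hM
    obtain ⟨a, c, M₁, j, hj, hpath, hcard₁, hends, hside⟩ := h.exists_hull_edge hS hM (by
      rintro rfl; simp at hcard)
    have hS₁ := hS.flipPath hpath
    have e : s(a, c) ::ₘ M₁ + R = M₁ + s(a, c) ::ₘ R := by simp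
    rw [e] at hS₁ hpath
    obtain ⟨j', hj', M', hpath', hfree, hends'⟩ := ih M₁ (s(a, c) ::ₘ R) (by omega) hS₁
      fun s hs p hp => by
        obtain ⟨s', hs', hp'⟩ := hends s (by simp [hs]) p hp
        exact hM s' hs' p hp'
    refine ⟨j + j', by omega, s(a, c) ::ₘ M', ?_, hfree.cons ?_, ?_⟩
    · have := hpath.trans hpath'
      simpa using this
    -- The untangling of `M₁` reuses its endpoints, which are all strictly on one side of ac.
    · intro ρ hρ hcross
      induction ρ using Sym2.ind with
      | _ e f =>
      obtain ⟨x, hx, hx'⟩ := hcross.exists_mem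
      obtain ⟨s₁, hs₁, he⟩ := hends' _ hρ e (by simp)
      obtain ⟨s₂, hs₂, hf⟩ := hends' _ hρ f (by simp)
      have h1 := hside _ hs₁ e he
      have h2 := hside _ hs₂ f hf
      nlinarith [orient_opposite hx hx' h1.ne, mul_pos_of_neg_of_neg h1 h2]
    · intro s hs p hp
      rcases Multiset.mem_cons.1 hs with rfl | hs
      · exact hends _ (by simp) p hp
      · obtain ⟨s', hs', hp'⟩ := hends' s hs p hp
        exact hends s' (by simp [hs']) p hp'

end Convex

/-! ### Initial values of the potentials -/

section Bounds

variable {P C T : Finset Plane} {F : Finset (Set Plane)} {n : ℕ}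

theorem total_endCount (T : Finset Plane) (S : Multiset Seg) :
    total (endCount T) S = ∑ p ∈ T, segDegree S p := by
  classical
  induction S using Multiset.induction with
  | empty => simp [total, segDegree]
  | cons s S ih =>
    simp only [total_cons, ih, segDegree_cons, Finset.sum_add_distrib, endCount,
      Finset.card_filter]
    omega

theorem OuterPosition.total_endCount_eq (h : OuterPosition P C T) {S : Multiset Seg}
    (hS : Valid P n S) : total (endCount T) S = T.card := by
  rw [total_endCount, Finset.card_eq_sum_ones]
  exact Finset.sum_congr rfl fun p hp => hS.2.2 p ((h.mem_iff p).2 (Or.inr hp))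

theorem OuterPosition.card_le (h : OuterPosition P C T) {S : Multiset Seg} (hS : Valid P n S) :
    T.card ≤ 2 * n := by
  rw [← h.total_endCount_eq hS]
  have := total_le_total (w := endCount T) (w' := fun _ => 2) (S := S)
    fun s hs => endCount_le_two (hS.2.1 s hs).1
  simpa [total, hS.1, mul_comm] using this

theorem OuterPosition.mem_of_endCount_eq_zero (h : OuterPosition P C T) {s : Seg}
    (hs : ∀ p ∈ s, p ∈ P) (h0 : endCount T s = 0) : ∀ p ∈ s, p ∈ C := by
  classical
  intro p hp
  refine ((h.mem_iff p).1 (hs p hp)).resolve_right fun hT => ?_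
  rw [endCount, Finset.card_eq_zero] at h0
  have : p ∈ T.filter (· ∈ s) := Finset.mem_filter.2 ⟨hT, hp⟩
  rw [h0] at this
  simp at this

/-- The half-planes avoid `C`, so a separated segment has an endpoint in `T`. Each such endpoint is
charged 5 · 4t + 1, and there are t of them. -/
theorem OuterPosition.total_energy_le (h : OuterPosition P C T) (hF : TangentFamily P C F)
    (hcard : F.card ≤ 4 * T.card) {S : Multiset Seg} (hS : Valid P n S) :
    total (energy F C T) S ≤ (20 * T.card + 1) * T.card := by
  classical
  -- The first rewrite also affects the coefficient; the last one restores it.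
  rw [← h.total_endCount_eq hS, ← total_mul, h.total_endCount_eq hS]
  refine total_le_total fun s hs => ?_
  have h1 := unsettledCount_le C T s
  have h2 : sepCount F s ≤ 4 * T.card * endCount T s := by
    rcases Nat.eq_zero_or_pos (endCount T s) with h0 | h0
    · have hC := h.mem_of_endCount_eq_zero (hS.2.1 s hs).2 h0
      rw [h0, mul_zero, Nat.le_zero, sepCount, Finset.card_eq_zero, Finset.filter_eq_empty_iff]
      rintro H hH ⟨⟨p, hp, hpH⟩, -⟩
      exact hF.avoids H hH p (hC p hp) hpH
    · exact ((Finset.card_filter_le _ _).trans hcard).trans (Nat.le_mul_of_pos_right _ h0)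
  rw [energy]
  nlinarith

theorem OuterPosition.total_freeCount_le (h : OuterPosition P C T) {S : Multiset Seg}
    (hS : Valid P n S) : total (freeCount (lineFamily T) C) S ≤ T.card ^ 2 * T.card := by
  classical
  conv_rhs => rw [← h.total_endCount_eq hS, ← total_mul, h.total_endCount_eq hS]
  refine total_le_total fun s hs => ?_
  rcases Nat.eq_zero_or_pos (endCount T s) with h0 | h0
  · have hC := h.mem_of_endCount_eq_zero (hS.2.1 s hs).2 h0
    rw [freeCount_of_hits]
    · simp
    · induction s using Sym2.ind with
      | _ a b => exact hits_of_mem_left (hC a (by simp))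
  · exact ((freeCount_le s).trans (lineFamily_card T)).trans (Nat.le_mul_of_pos_right _ h0)

/-- The critical product c e has order t⁴; t ≤ 2n trades one factor t for n. It also forces t = 0
when n = 0. -/
theorem flip_bound {n t e c p y j m : ℕ} (ht : t ≤ 2 * n) (he : e ≤ (20 * t + 1) * t)
    (hc : c ≤ t ^ 2) (hp : p ≤ t) (hy : y ≤ t ^ 2 * t) (hj : j ≤ n)
    (hm : m ≤ (9 * (n + 2) + 4 * c) * e + (n + 2) * p + y) :
    j + m ≤ 1000 * (1 + t) ^ 3 * n := by
  rcases Nat.eq_zero_or_pos n with rfl | hn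
  · obtain rfl : t = 0 := by omega
    obtain rfl : c = 0 := by simpa using hc
    obtain rfl : e = 0 := by simpa using he
    obtain rfl : p = 0 := by simpa using hp
    obtain rfl : y = 0 := by simpa using hy
    omega
  obtain ⟨u, hu⟩ : ∃ u, u = 1 + t := ⟨_, rfl⟩
  have htu : t ≤ u := by omega
  have h1u : 1 ≤ u := by omega
  have ht2 : t ^ 2 ≤ 2 * n * u := by
    rw [sq]; exact Nat.mul_le_mul ht htu
  have hA : 9 * (n + 2) + 4 * c ≤ 35 * n * u := by nlinarith
  have hE : e ≤ 20 * u * u := by nlinarith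
  have h1 : (9 * (n + 2) + 4 * c) * e ≤ 35 * n * u * (20 * u * u) := Nat.mul_le_mul hA hE
  have hu2 : u ≤ u ^ 3 := Nat.le_self_pow (by norm_num) u
  have hu3 : 1 ≤ u ^ 3 := Nat.one_le_pow _ _ h1u
  have h2 : (n + 2) * p ≤ 3 * n * u ^ 3 :=
    Nat.mul_le_mul (by omega) ((hp.trans htu).trans hu2)
  have h3 : t ^ 2 * t ≤ 2 * n * u * u := Nat.mul_le_mul ht2 htu
  have h4 : 2 * n * u * u ≤ 2 * n * u ^ 3 := by
    have : u * u ≤ u ^ 3 := by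
      rw [← sq]; exact Nat.pow_le_pow_right h1u (by norm_num)
    nlinarith
  have h5 : n ≤ n * u ^ 3 := Nat.le_mul_of_pos_right _ hu3
  have h6 : 35 * n * u * (20 * u * u) = 700 * (n * u ^ 3) := by ring
  rw [← hu]
  have h7 : 1000 * u ^ 3 * n = 1000 * (n * u ^ 3) := by ring
  have h8 : 3 * n * u ^ 3 = 3 * (n * u ^ 3) := by ring
  have h9 : 2 * n * u ^ 3 = 2 * (n * u ^ 3) := by ring
  omega

/-- Every matching can be untangled with `O(t³ n)` flips. -/
theorem OuterPosition.exists_untangling (h : OuterPosition P C T) {S : Multiset Seg}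
    (hS : Valid P n S) :
    ∃ k ≤ 1000 * (1 + T.card) ^ 3 * n, ∃ S', FlipPath k S S' ∧ CrossingFree S' := by
  classical
  obtain ⟨F, hcard, hF1, hF2⟩ := h.exists_tangent_family
  have hF : TangentFamily P C F := ⟨fun H hH => (hF1 H hH).1, fun H hH => (hF1 H hH).2, hF2⟩
  obtain ⟨M, R, rfl, hM, hR⟩ : ∃ M R, S = M + R ∧ (∀ s ∈ M, ∀ p ∈ s, p ∈ C) ∧
      ∀ s ∈ R, 1 ≤ endCount T s := by
    refine ⟨S.filter fun s => endCount T s = 0, S.filter fun s => ¬ endCount T s = 0,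
      (Multiset.filter_add_not _ S).symm, fun s hs => ?_, fun s hs => ?_⟩
    · obtain ⟨h1, h2⟩ := Multiset.mem_filter.1 hs
      exact h.mem_of_endCount_eq_zero (hS.2.1 s h1).2 h2
    · exact Nat.one_le_iff_ne_zero.2 (Multiset.mem_filter.1 hs).2
  obtain ⟨j, hj, M', hpath, hfree, hends⟩ := h.untangle_convex M.card M R rfl hS hM
  have hS' := hS.flipPath hpath
  have hG : Clean C (M' + R) M' := by
    refine ⟨Multiset.le_add_right _ _, fun s hs => ?_, hfree⟩
    induction s using Sym2.ind with
    | _ a b =>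
    obtain ⟨s', hs', ha⟩ := hends _ hs a (by simp)
    exact hits_of_mem_left (hM s' hs' a ha)
  obtain ⟨m, hm, S'', hpath', hfree'⟩ := h.untangle hF _ (M' + R) M' hS' hG le_rfl
  refine ⟨j + m, ?_, S'', hpath.trans hpath', hfree'⟩
  refine flip_bound (h.card_le hS) (h.total_energy_le hF hcard hS') (lineFamily_card T) ?_
    (h.total_freeCount_le hS') (hj.trans ?_) hm
  · have h1 : R.card ≤ total (endCount T) R := by
      have := total_le_total (w := fun _ => 1) (w' := endCount T) (S := R) hR
      simpa [total] using this
    have h2 : total (endCount T) (M + R) = total (endCount T) M + total (endCount T) R := by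
      simp [total]
    rw [h.total_endCount_eq hS] at h2
    have h3 := Multiset.countP_le_card (Hits C) M'
    have h4 := Multiset.countP_le_card (Hits C) R
    rw [pending, Multiset.countP_add]
    omega
  · rw [← hS.1]; simp

end Bounds

/-! ### From untangling to a strategy -/

/-- A function that can be decreased along the arcs of a directed graph yields a strategy. -/
theorem exists_strategy {V : Type} (F : Digraph V) (d : V → ℕ)
    (hd : ∀ v, ¬ IsSink F v → ∃ w, F.Adj v w ∧ d w < d v) :
    ∃ RI : Digraph V, IsRIStrategy F RI ∧ (∀ σ : FlipSequence RI, σ.length ≤ d σ.head) ∧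
      ∀ v, ∃ σ : FlipSequence RI, σ.head = v ∧ IsSink F σ.last := by
  choose! f hf using hd
  have hsink : ∀ v, IsSink (⟨fun v w => ¬ IsSink F v ∧ w = f v⟩ : Digraph V) v ↔ IsSink F v := by
    intro v
    constructor
    · intro h
      by_contra hn
      exact h (f v) ⟨hn, rfl⟩
    · rintro h w ⟨hn, -⟩
      exact hn h
  refine ⟨⟨fun v w => ¬ IsSink F v ∧ w = f v⟩, ⟨⟨?_, hsink⟩, ?_⟩, ?_, ?_⟩
  · rintro v w ⟨h, rfl⟩
    exact (hf v h).1
  · intro v hv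
    exact ⟨f v, ⟨hv, rfl⟩, fun w hw => hw.2⟩
  · intro σ
    -- Each arc lowers d by at least one, so d after i arcs is at most the initial value minus i.
    have key : ∀ i : ℕ, ∀ hi : i < σ.length + 1, d (σ.toFun ⟨i, hi⟩) + i ≤ d σ.head := by
      intro i
      induction i with
      | zero => intro hi; exact le_rfl
      | succ i ih =>
        intro hi
        have h1 := ih (by omega)
        obtain ⟨h2, h3⟩ := σ.step ⟨i, by omega⟩
        have h4 := (hf _ h2).2
        rw [← h3] at h4
        simp only [Fin.castSucc_mk, Fin.succ_mk] at h4
        omega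
    have := key σ.length (by omega)
    omega
  · intro v
    induction hn : d v using Nat.strong_induction_on generalizing v with
    | _ m ih =>
    by_cases hv : IsSink F v
    · exact ⟨RelSeries.singleton _ v, by simp, by simpa using hv⟩
    · obtain ⟨σ, hσ, hσ'⟩ := ih _ (hn ▸ (hf v hv).2) (f v) rfl
      exact ⟨σ.cons v ⟨hv, hσ⟩, by simp, by simpa using hσ'⟩

theorem mainTheorem10 :
    ∃ K : ℕ, ∀ (n : ℕ) (P C T : Finset Plane),
      (P : Set Plane) = (C : Set Plane) ∪ (T : Set Plane) →
      Disjoint C T →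
      GeneralPosition P →
      ConvexIndependent ℝ (fun c : {x : Plane // x ∈ C} => (c : Plane)) →
      (∀ q ∈ T, q ∉ convexHull ℝ (C : Set Plane)) →
      ∃ RI : Digraph (Config P n IsPerfectMatching),
        IsRIStrategy (flipGraph P n IsPerfectMatching) RI ∧
        (∀ σ : FlipSequence RI, σ.length ≤ K * (1 + T.card) ^ 3 * n) ∧
        (∀ S : Config P n IsPerfectMatching, ∃ σ : FlipSequence RI,
          σ.head = S ∧ IsUntangleSequence (flipGraph P n IsPerfectMatching) σ ∧
          CrossingFree σ.last.1) := by
  classical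
  refine ⟨1000, fun n P C T hPCT hdisj hgp hconv hout => ?_⟩
  have h : OuterPosition P C T := by
    refine ⟨fun p => ?_, hdisj, hgp, hconv, hout⟩
    have : p ∈ (P : Set Plane) ↔ p ∈ (C : Set Plane) ∪ (T : Set Plane) := by rw [hPCT]
    simpa using this
  have hsink : ∀ S : Config P n IsPerfectMatching,
      IsSink (flipGraph P n IsPerfectMatching) S → CrossingFree S.1 := by
    intro S hS s₁ h1 s₂ h2 hc
    obtain ⟨R, hR⟩ := exists_cons_cons h1 h2 hc.ne
    have hv : Valid P n S.1 := S.2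
    induction s₁ using Sym2.ind with
    | _ a b =>
    induction s₂ using Sym2.ind with
    | _ c d =>
    rw [hR] at hv
    have hf := hv.isFlip hgp hc
    refine hS ⟨_, hv.flip hf⟩ ?_
    change IsFlip S.1 _
    rw [hR]
    exact hf
  -- The function decreased by the strategy is the least number of flips to a crossing-free
  -- matching.
  have hex : ∀ S : Config P n IsPerfectMatching, ∃ k, ∃ S', FlipPath k S.1 S' ∧ CrossingFree S' :=
    fun S => by
      obtain ⟨k, -, hk⟩ := h.exists_untangling (show Valid P n S.1 from S.2)
      exact ⟨k, hk⟩
  have hle : ∀ S, Nat.find (hex S) ≤ 1000 * (1 + T.card) ^ 3 * n := fun S => by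
    obtain ⟨k, hk, hk'⟩ := h.exists_untangling (show Valid P n S.1 from S.2)
    exact (Nat.find_min' (hex S) hk').trans hk
  obtain ⟨RI, h1, h2, h3⟩ := exists_strategy (flipGraph P n IsPerfectMatching)
    (fun S => Nat.find (hex S)) (by
      intro S hS
      obtain ⟨S', hpath, hfree⟩ := Nat.find_spec (hex S)
      generalize hk : Nat.find (hex S) = k at hpath
      cases hpath with
      | refl =>
        refine absurd (fun W hW => ?_) hS
        obtain ⟨a, b, c, d, R, e, -, hc, -⟩ : IsFlip S.1 W.1 := hW
        exact hfree s(a, b) (by rw [e]; simp) s(c, d) (by rw [e]; simp) hc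
      | @step k _ S₁ _ hf hpath =>
        have hv : Valid P n S₁ := Valid.flip (show Valid P n S.1 from S.2) hf
        refine ⟨⟨S₁, hv⟩, hf, ?_⟩
        have := Nat.find_min' (hex ⟨S₁, hv⟩) ⟨S', hpath, hfree⟩
        omega)
  refine ⟨RI, h1, fun σ => (h2 σ).trans (hle _), fun S => ?_⟩
  obtain ⟨σ, hσ, hσ'⟩ := h3 S
  exact ⟨σ, hσ, hσ', hsink _ hσ'⟩
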